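/- Let $M$ be a smooth ($C^\infty$, finite-dimensional, Hausdorff, second-countable, boundaryless) manifold with a smooth affine connection $\nabla$, let $p\in M$, and let $\exp_p:\mathcal D_p\to M$ be the exponential map of $\nabla$ at $p$ on its maximal domain $\mathcal D_p\subset T_pM$ (that is, $v\in\mathcal D_p$ iff the geodesic $\gamma_v$ with $\gamma_v(0)=p$, $\gamma_v'(0)=v$ is defined on $[0,1]$, and $\exp_p(v)=\gamma_v(1)$). Let $\mathcal P^\infty(M)$ be the set of piecewise smooth paths in $M$, meaning here: the continuous $\alpha:[0,1]\to M$ that are piecewise smooth on $[0,1)$, i.e. there is a set $S\subset[0,1]$ of break points with $S\cap[0,d]$ finite for every $d<1$, such that $\alpha$ is $C^\infty$ on every $[s,t]\subset[0,1)$ with $s<t$ and $(s,t)\cap S=\emptyset$. (Break points may accumulate at $1$ only.) * $\exp_p$ is *weakly proper* if for every $0<a\le+\infty$ and every continuous curve $\bar\alpha:[0,a)\to\mathcal D_p$ such that $\exp_p\circ\bar\alpha$ is right-extendible (i.e. $\lim_{t\to a}\exp_p(\bar\alpha(t))$ exists in $M$), there is a compact set $K\subset\mathcal D_p$ with $\bar\alpha([0,a))\subset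 K$. * $\exp_p$ has the *continuation property for $\mathcal P^\infty(M)$* if for every $\alpha\in\mathcal P^\infty(M)$, every $0<b\le 1$ and every continuous $\bar\alpha:[0,b)\to\mathcal D_p$ with $\exp_p\circ\bar\alpha=\alpha|_{[0,b)}$, there is a sequence $(t_k)$ in $[0,b)$ with $t_k\to b$ such that $(\bar\alpha(t_k))$ converges to a point of $\mathcal D_p$. **Proposition.** $\exp_p:\mathcal D_p\to M$ is weakly proper if and only if it has the continuation property for $\mathcal P^\infty(M)$. -/

import Mathlib

open Set Filter Topology
open scoped Manifold ContDiff Bundle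

noncomputable section

/-! ### Continuation property and weak properness

A map between spaces is given by a total function `F : X → Y` together with its domain `D : Set X`;
only the values of `F` on `D` matter. Curves are total functions on `ℝ` of which only the
restriction to the stated interval matters. -/

/-- `F : D → Y` has the continuation property for a set `P` of paths in `Y` (functions on `ℝ`,
restricted to `[0, 1]`): for all `α ∈ P` and all continuous `c : [0, b) → D`, where `0 < b ≤ 1`,
with `F ∘ c = α` on `[0, b)`, there is a sequence `t k` in `[0, b)` converging to `b` for which
`c (t k)` converges in `D`. -/
def HasContinuationProperty {X Y : Type*} [TopologicalSpace X]
    (F : X → Y) (D : Set X) (P : Set (ℝ → Y)) : Prop :=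
  ∀ α ∈ P, ∀ b : ℝ, 0 < b → b ≤ 1 → ∀ c : ℝ → X,
    ContinuousOn c (Ico 0 b) → MapsTo c (Ico 0 b) D → EqOn (F ∘ c) α (Ico 0 b) →
    ∃ t : ℕ → ℝ, (∀ k, t k ∈ Ico 0 b) ∧ Tendsto t atTop (𝓝 b) ∧
      ∃ x ∈ D, Tendsto (fun k => c (t k)) atTop (𝓝 x)

/-- Every continuous curve `c : J → D` whose image curve `F ∘ c` has a limit in `Y` along the
filter `l` (the right end of the interval `J`) stays in a compact subset of `D`. -/
def ExtendibleImageInCompact {X Y : Type*} [TopologicalSpace X] [TopologicalSpace Y]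
    (F : X → Y) (D : Set X) (J : Set ℝ) (l : Filter ℝ) : Prop :=
  ∀ c : ℝ → X, ContinuousOn c J → MapsTo c J D → (∃ q : Y, Tendsto (F ∘ c) l (𝓝 q)) →
    ∃ K : Set X, IsCompact K ∧ K ⊆ D ∧ c '' J ⊆ K

/-- `F : D → Y` is weakly proper: for all `0 < a ≤ ∞` and all continuous `c : [0, a) → D` such that
`F ∘ c` is right-extendible (`F (c t)` has a limit in `Y` as `t → a`), the image of `c` lies in
a compact subset of `D`. The first conjunct is the case `a < ∞`, the second the case `a = ∞`. -/
def IsWeaklyProper {X Y : Type*} [TopologicalSpace X] [TopologicalSpace Y]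
    (F : X → Y) (D : Set X) : Prop :=
  (∀ a : ℝ, 0 < a → ExtendibleImageInCompact F D (Ico 0 a) (𝓝[<] a)) ∧
    ExtendibleImageInCompact F D (Ici 0) atTop

section Manifold

variable {E : Type*} [NormedAddCommGroup E] [NormedSpace ℝ E]
  {M : Type*} [TopologicalSpace M] [ChartedSpace E M]

variable (E M) in
/-- The piecewise smooth paths `[0, 1] → M`: continuous on `[0, 1]` and piecewise smooth on
`[0, 1)`. The set `S` of break points may accumulate at the end point `1`, but has only finitely
many points in `[0, d]` for each `d < 1`; away from the breaks, `α` is smooth on closed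
intervals (with one-sided derivatives at the ends). -/
def piecewiseSmoothPaths : Set (ℝ → M) :=
  {α | ContinuousOn α (Icc 0 1) ∧
    ∃ S : Set ℝ, (∀ d < 1, (S ∩ Icc 0 d).Finite) ∧
      ∀ s t : ℝ, 0 ≤ s → s < t → t < 1 → Disjoint (Ioo s t) S →
        ContMDiffOn 𝓘(ℝ, ℝ) 𝓘(ℝ, E) ∞ α (Icc s t)}

/-! ### Geodesics and the exponential map of an affine connection -/

variable (E) in
/-- The velocity `γ'(t) ∈ T_{γ(t)} M`. -/
def velocity (γ : ℝ → M) (t : ℝ) : TangentSpace 𝓘(ℝ, E) (γ t) :=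
  mfderiv 𝓘(ℝ, ℝ) 𝓘(ℝ, E) γ t (1 : ℝ)

variable [IsManifold 𝓘(ℝ, E) 1 M]

/-- The covariant derivative at time `t₀` of a vector field `V` along the curve `γ`. In the local
frame of `TM` given by the preferred chart at `γ t₀`, write `V = ∑ Vⁱ eᵢ`. Then
`∇_{γ'} V = ∑ (Vⁱ)' eᵢ + ∑ Vⁱ ∇_{γ'} eᵢ`; the second summand is `∇_{γ'(t₀)} W`, where `W` is
the local field with the constant coefficients `Vⁱ(t₀)` (`FiberBundle.extend`).
Mathlib writes `cov W x u` for `(∇_u W)(x)`. -/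
def covDerivAlong (cov : CovariantDerivative 𝓘(ℝ, E) E (TangentSpace 𝓘(ℝ, E) : M → Type _))
    (γ : ℝ → M) (V : ∀ t, TangentSpace 𝓘(ℝ, E) (γ t)) (t₀ : ℝ) : TangentSpace 𝓘(ℝ, E) (γ t₀) :=
  (trivializationAt E (TangentSpace 𝓘(ℝ, E)) (γ t₀)).symm (γ t₀)
      (deriv (fun t => (trivializationAt E (TangentSpace 𝓘(ℝ, E)) (γ t₀)
        (⟨γ t, V t⟩ : TangentBundle 𝓘(ℝ, E) M)).2) t₀)
    + cov (FiberBundle.extend E (V t₀)) (γ t₀) (velocity E γ t₀)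

/-- `γ` is a geodesic on the open set `J` of times: it is smooth and `∇_{γ'} γ' = 0` on `J`. -/
def IsGeodesicOn (cov : CovariantDerivative 𝓘(ℝ, E) E (TangentSpace 𝓘(ℝ, E) : M → Type _))
    (γ : ℝ → M) (J : Set ℝ) : Prop :=
  ContMDiffOn 𝓘(ℝ, ℝ) 𝓘(ℝ, E) ∞ γ J ∧ ∀ t ∈ J, covDerivAlong cov γ (velocity E γ) t = 0

/-- `γ` restricts to a geodesic on an open interval containing `[0, 1]`, with initial
velocity `v ∈ T_p M`. -/
def IsGeodesicFrom (cov : CovariantDerivative 𝓘(ℝ, E) E (TangentSpace 𝓘(ℝ, E) : M → Type _))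
    (p : M) (v : TangentSpace 𝓘(ℝ, E) p) (γ : ℝ → M) : Prop :=
  (∃ J : Set ℝ, IsOpen J ∧ J.OrdConnected ∧ 0 ∈ J ∧ 1 ∈ J ∧ IsGeodesicOn cov γ J) ∧
    (⟨γ 0, velocity E γ 0⟩ : TangentBundle 𝓘(ℝ, E) M) = ⟨p, v⟩

/-- The maximal domain `𝒟_p ⊆ T_p M` of the exponential map at `p`. -/
def expDomain (cov : CovariantDerivative 𝓘(ℝ, E) E (TangentSpace 𝓘(ℝ, E) : M → Type _))
    (p : M) : Set (TangentSpace 𝓘(ℝ, E) p) :=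
  {v | ∃ γ : ℝ → M, IsGeodesicFrom cov p v γ}

open Classical in
/-- The exponential map `exp_p v = γ_v(1)`, where `γ_v` is the geodesic with initial velocity `v`
(unique on `[0, 1]` for a smooth connection on a Hausdorff manifold); the value outside of
`expDomain cov p` is irrelevant. -/
def expMap (cov : CovariantDerivative 𝓘(ℝ, E) E (TangentSpace 𝓘(ℝ, E) : M → Type _))
    (p : M) (v : TangentSpace 𝓘(ℝ, E) p) : M :=
  if h : ∃ γ : ℝ → M, IsGeodesicFrom cov p v γ then h.choose 1 else p

end Manifold

end

/-! Weak properness gives the continuation property by compactness: if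
$\exp_p\circ\bar\alpha=\alpha$ on $[0,b)$, the image curve has the limit $\alpha(b)$, so
$\bar\alpha$ stays in a compact subset of $\mathcal D_p$ and a subsequence converges.

For the converse, suppose that a continuous curve `c` in `D` lies in no compact subset of `D`
although `F ∘ c` tends to `q`. The image `F ∘ c` need not be piecewise smooth, so `c` is replaced by
a smooth curve with the same two features. Take a compact exhaustion `K n` of `D` and a neighborhood
basis `U n` of `q`. The open set $V_n = (D\cap F^{-1}(U_n))\setminus K_n$ is met by `c` at
arbitrarily late times, but `c` may return to `K n` again and again, and its excursions may lie in
different components of $V_n$. An ultrafilter of times that leaves all `K n` selects one component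
`O n` for each `n` (`exists_component_of_ultrafilter`): long excursions start on a compact part of a
boundary, so their starting points have a limit along the ultrafilter. As the ultrafilter is the
same for all `n`, consecutive components meet (`exists_chain_of_not_compact`). A smooth curve
running through the chain (`exists_contDiff_curve_of_chain`) leaves every compact subset of `D`
while its image tends to `q`. Reparametrized to `[0, 1)` and completed by `q`, the image is an
admissible path that violates the continuation property (`HasContinuationProperty.not_escaping`).

This argument needs only that `D` is open and `F` is smooth. For the exponential map this is smooth
dependence of geodesics on the initial velocity. Local flows of smooth ODEs come from the inverse
function theorem in a space of continuous curves; in a chart the geodesic equation is such an ODE;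
local geodesic flows are then composed along a given geodesic by a connectedness argument
(`IsGeodesicOn.hasSmoothGeodesicFamily`). -/

/-! ### Curves escaping an open set -/

/-- An open subset of a finite-dimensional space has an exhaustion by compact sets. -/
theorem IsOpen.exists_compact_exhaustion {E : Type*} [NormedAddCommGroup E] [NormedSpace ℝ E]
    [FiniteDimensional ℝ E] {D : Set E} (hD : IsOpen D) :
    ∃ K : ℕ → Set E, (∀ n, IsCompact (K n)) ∧ (∀ n, K n ⊆ D) ∧
      (∀ n, K n ⊆ interior (K (n + 1))) ∧ ∀ x ∈ D, ∃ n, x ∈ K n := by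
  have : ProperSpace E := FiniteDimensional.proper ℝ E
  have : LocallyCompactSpace D := hD.locallyCompactSpace
  let L := CompactExhaustion.choice D
  refine ⟨fun n => Subtype.val '' L n, fun n => (L.isCompact n).image continuous_subtype_val,
    fun n => Subtype.coe_image_subset _ _, fun n => ?_, fun x hx => ?_⟩
  · have h := hD.isOpenMap_subtype_val.image_interior_subset (L (n + 1))
    exact (image_mono (L.subset_interior_succ n)).trans h
  · obtain ⟨n, hn⟩ := L.exists_mem ⟨x, hx⟩
    exact ⟨n, ⟨x, hx⟩, hn, rfl⟩

/-- Let `V` be open and let `c` be a continuous curve which eventually runs in `V` whenever it is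
outside of the compact set `K'`, and which hits `K'` only in points of the closed set `C` such
that `C ∩ ∂K' ⊆ V`. If `c` is outside of `K'` frequently, in the sense of an ultrafilter
converging to the end of the parameter interval `J`, then for almost all these times `c` lies in a
single connected component of `V`. -/
theorem exists_component_of_ultrafilter {E : Type*} [TopologicalSpace E] [LocallyConnectedSpace E]
    [T2Space E]
    {J : Set ℝ} (hJ : J.OrdConnected) {c : ℝ → E} (hc : ContinuousOn c J)
    {𝒰 : Ultrafilter ℝ} {τ : ℝ} (hτ : τ ∈ J) (h𝒰 : ∀ s ∈ J, ∀ᶠ t in (𝒰 : Filter ℝ), t ∈ J ∧ s ≤ t)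
    {V K' C : Set E} (hV : IsOpen V) (hK' : IsCompact K') (hC : IsClosed (K' ∩ C))
    (hcV : ∀ t ∈ J, τ ≤ t → c t ∉ K' → c t ∈ V) (hcC : ∀ t ∈ J, τ ≤ t → c t ∈ K' → c t ∈ C)
    (hCV : ∀ x ∈ K' ∩ C, x ∉ interior K' → x ∈ V)
    (hout : ∀ᶠ t in (𝒰 : Filter ℝ), c t ∉ K') :
    ∃ O : Set E, IsOpen O ∧ IsPreconnected O ∧ O ⊆ V ∧ ∀ᶠ t in (𝒰 : Filter ℝ), c t ∈ O := by
  have hIcc : ∀ t ∈ J, Icc τ t ⊆ J := fun t ht => hJ.out hτ ht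
  -- If `K'` is visited, the last exit points lie in the compact set `(K' ∩ C) \ interior K' ⊆ V`
  -- and converge along `𝒰` to some `y`. They are then almost always in the component of `y`, and
  -- the arc from the exit point to `c t` stays in `V`. If there is no visit, the whole tail of `c`
  -- is a connected subset of `V`.
  rcases 𝒰.em (fun t => ∃ s ∈ Icc τ t, c s ∈ K') with h | h
  · -- the last visit of `K'` before the time `t`
    have key : ∀ᶠ t in (𝒰 : Filter ℝ), ∃ s ∈ Icc τ t, t ∈ J ∧ c s ∈ (K' ∩ C) \ interior K' ∧
        c '' Icc s t ⊆ V := by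
      filter_upwards [h, h𝒰 τ hτ, hout] with t ⟨s₀, hs₀, hs₀K⟩ ⟨htJ, hτt⟩ htK
      have hcl : IsClosed (Icc τ t ∩ c ⁻¹' K') :=
        (hc.mono (hIcc t htJ)).preimage_isClosed_of_isClosed isClosed_Icc hK'.isClosed
      have hcomp : IsCompact (Icc τ t ∩ c ⁻¹' K') :=
        isCompact_Icc.of_isClosed_subset hcl inter_subset_left
      obtain ⟨s, hs, hsmax⟩ := hcomp.exists_isGreatest ⟨s₀, hs₀, hs₀K⟩
      have hsJ : s ∈ J := hIcc t htJ hs.1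
      have hst : s < t := lt_of_le_of_ne hs.1.2 fun h => htK (h ▸ hs.2)
      have hafter : ∀ r ∈ Ioc s t, c r ∉ K' := fun r hr hrK =>
        absurd (hsmax ⟨⟨hs.1.1.trans hr.1.le, hr.2⟩, hrK⟩) (not_le.2 hr.1)
      have hnint : c s ∉ interior K' := by
        intro hint
        have h1 : ContinuousWithinAt c (Ioc s t) s :=
          (hc s hsJ).mono fun r hr => hIcc t htJ ⟨hs.1.1.trans hr.1.le, hr.2⟩
        have h2 := h1.eventually (isOpen_interior.mem_nhds hint)
        have : (𝓝[Ioc s t] s).NeBot := by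
          rw [nhdsWithin_Ioc_eq_nhdsGT hst]; infer_instance
        obtain ⟨r, hr1, hr2⟩ := (h2.and self_mem_nhdsWithin).exists
        exact hafter r hr2 (interior_subset hr1)
      have hsC : c s ∈ (K' ∩ C) \ interior K' := ⟨⟨hs.2, hcC s hsJ hs.1.1 hs.2⟩, hnint⟩
      refine ⟨s, hs.1, htJ, hsC, ?_⟩
      rintro _ ⟨r, hr, rfl⟩
      rcases eq_or_lt_of_le hr.1 with rfl | hsr
      · exact hCV _ hsC.1 hsC.2
      · exact hcV r (hIcc t htJ ⟨hs.1.1.trans hr.1, hr.2⟩) (hs.1.1.trans hr.1)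
          (hafter r ⟨hsr, hr.2⟩)
    have key' : ∀ t, ∃ s, (∃ s ∈ Icc τ t, t ∈ J ∧ c s ∈ (K' ∩ C) \ interior K' ∧
        c '' Icc s t ⊆ V) → s ∈ Icc τ t ∧ t ∈ J ∧ c s ∈ (K' ∩ C) \ interior K' ∧
        c '' Icc s t ⊆ V := fun t => by
      by_cases hh : ∃ s ∈ Icc τ t, t ∈ J ∧ c s ∈ (K' ∩ C) \ interior K' ∧ c '' Icc s t ⊆ V
      · obtain ⟨s, hs⟩ := hh; exact ⟨s, fun _ => hs⟩
      -- A default value; `σ` is only used at times with an exit point.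
      · exact ⟨0, fun h => absurd h hh⟩
    choose σ hσ using key'
    have hQ : IsCompact ((K' ∩ C) \ interior K') :=
      (hK'.of_isClosed_subset hC inter_subset_left).diff isOpen_interior
    obtain ⟨y, hyQ, hy⟩ := hQ.ultrafilter_le_nhds (𝒰.map (c ∘ σ)) (by
      rw [le_principal_iff]
      change ∀ᶠ t in (𝒰 : Filter ℝ), c (σ t) ∈ _
      filter_upwards [key] with t ht using (hσ t ht).2.2.1)
    have hyV : y ∈ V := hCV y hyQ.1 hyQ.2
    refine ⟨connectedComponentIn V y, hV.connectedComponentIn, isPreconnected_connectedComponentIn,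
      connectedComponentIn_subset _ _, ?_⟩
    have hmem : ∀ᶠ t in (𝒰 : Filter ℝ), c (σ t) ∈ connectedComponentIn V y :=
      hy (hV.connectedComponentIn.mem_nhds (mem_connectedComponentIn hyV))
    filter_upwards [hmem, key] with t h1 h2
    obtain ⟨h3, h4, -, h5⟩ := hσ t h2
    rw [connectedComponentIn_eq h1]
    refine IsPreconnected.subset_connectedComponentIn
      (isPreconnected_Icc.image c (hc.mono fun r hr => hIcc t h4 ⟨h3.1.trans hr.1, hr.2⟩))
      (mem_image_of_mem c (left_mem_Icc.2 h3.2)) h5 (mem_image_of_mem c (right_mem_Icc.2 h3.2))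
  · have hno : ∀ t ∈ J, τ ≤ t → c t ∈ V := by
      intro t ht hτt
      obtain ⟨t', h1, h2⟩ := (h.and (h𝒰 t ht)).exists
      exact hcV t ht hτt fun hK => h1 ⟨t, ⟨hτt, h2.2⟩, hK⟩
    refine ⟨connectedComponentIn V (c τ), hV.connectedComponentIn,
      isPreconnected_connectedComponentIn, connectedComponentIn_subset _ _, ?_⟩
    filter_upwards [h𝒰 τ hτ] with t ht
    refine IsPreconnected.subset_connectedComponentIn
      (isPreconnected_Icc.image c (hc.mono (hIcc t ht.1))) (mem_image_of_mem c (left_mem_Icc.2 ht.2))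
      ?_ (mem_image_of_mem c (right_mem_Icc.2 ht.2))
    rintro _ ⟨r, hr, rfl⟩
    exact hno r (hIcc t ht.1 hr) hr.1

/-- If a continuous curve in `D` is not contained in a compact subset of `D`, although its image
under `F` converges to `q`, then there is a chain of connected open sets which leaves all compact
subsets of `D` and on which `F` converges to `q`. -/
theorem exists_chain_of_not_compact {E : Type*} [TopologicalSpace E] [LocallyConnectedSpace E]
    [T2Space E] {M : Type*} [TopologicalSpace M] [RegularSpace M]
    {D : Set E} (hD : IsOpen D) {F : E → M} (hF : ContinuousOn F D)
    {K : ℕ → Set E} (hK : ∀ n, IsCompact (K n)) (hKD : ∀ n, K n ⊆ D)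
    (hKi : ∀ n, K n ⊆ interior (K (n + 1)))
    {J : Set ℝ} (hJ : J.OrdConnected) (h0 : IsLeast J 0) {l : Filter ℝ} [l.NeBot]
    (hl : ∀ s, s ∈ l ↔ ∃ τ ∈ J, J ∩ Ici τ ⊆ s)
    {c : ℝ → E} (hc : ContinuousOn c J) (hcD : MapsTo c J D) {q : M}
    (hq : Tendsto (F ∘ c) l (𝓝 q))
    (hnot : ¬ ∃ K : Set E, IsCompact K ∧ K ⊆ D ∧ c '' J ⊆ K)
    {U : ℕ → Set M} (hU : ∀ n, IsOpen (U n)) (hqU : ∀ n, q ∈ U n) :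
    ∃ (x : ℕ → E) (O : ℕ → Set E), ∀ n, IsOpen (O n) ∧ IsPreconnected (O n) ∧
      O n ⊆ D ∧ (∀ y ∈ O n, F y ∈ U n) ∧ Disjoint (O n) (K n) ∧ x n ∈ O n ∧ x n ∈ O (n + 1) := by
  have hmono : Monotone K := monotone_nat_of_le_succ fun n => (hKi n).trans interior_subset
  have hlJ : ∀ s ∈ J, ∀ᶠ t in l, t ∈ J ∧ s ≤ t := fun s hs => (hl _).2 ⟨s, hs, fun t ht => ht⟩
  -- A tail inside `K n`, together with the compact initial arc, would give a compact set excluded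
  -- by `hnot`.
  have hfreq : ∀ n, ∃ᶠ t in l, c t ∉ K n := by
    intro n hn
    obtain ⟨τ, hτ, hτn⟩ := (hl _).1 hn
    refine hnot ⟨K n ∪ c '' Icc 0 τ, (hK n).union (isCompact_Icc.image_of_continuousOn
      (hc.mono (hJ.out h0.1 hτ))), union_subset (hKD n) ?_, ?_⟩
    · rintro _ ⟨r, hr, rfl⟩
      exact hcD (hJ.out h0.1 hτ hr)
    · rintro _ ⟨r, hr, rfl⟩
      rcases le_total r τ with h | h
      · exact Or.inr ⟨r, ⟨h0.2 hr, h⟩, rfl⟩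
      · exact Or.inl (not_not.1 (hτn ⟨hr, h⟩))
  have hne : (⨅ n, l ⊓ 𝓟 {t | c t ∉ K n}).NeBot := by
    refine iInf_neBot_of_directed' (Antitone.directed_ge fun m n hmn => ?_) fun n => ?_
    · exact inf_le_inf_left _ (principal_mono.2 fun t ht h => ht (hmono hmn h))
    · exact frequently_mem_iff_neBot.1 (hfreq n)
  -- A single ultrafilter serves all `n`, so that `O n` and `O (n + 1)` have a common point `c t`.
  set 𝒰 : Ultrafilter ℝ := @Ultrafilter.of _ (⨅ n, l ⊓ 𝓟 {t | c t ∉ K n}) hne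
  have h𝒰 : (𝒰 : Filter ℝ) ≤ ⨅ n, l ⊓ 𝓟 {t | c t ∉ K n} := Ultrafilter.of_le _
  have h𝒰l : (𝒰 : Filter ℝ) ≤ l := (h𝒰.trans (iInf_le _ 0)).trans inf_le_left
  have h𝒰K : ∀ n, ∀ᶠ t in (𝒰 : Filter ℝ), c t ∉ K n := fun n =>
    ((h𝒰.trans (iInf_le _ n)).trans inf_le_right) (mem_principal_self _)
  have hO : ∀ n, ∃ O : Set E, IsOpen O ∧ IsPreconnected O ∧ O ⊆ (D ∩ F ⁻¹' U n) \ K n ∧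
      ∀ᶠ t in (𝒰 : Filter ℝ), c t ∈ O := by
    intro n
    obtain ⟨C, hCq, hCc, hCU⟩ := exists_mem_nhds_isClosed_subset ((hU n).mem_nhds (hqU n))
    obtain ⟨τ, hτ, hτC⟩ := (hl _).1 (hq hCq)
    -- Exits are taken from `K (n + 1)` rather than `K n`: since `K n ⊆ interior (K (n + 1))`, the
    -- exit points avoid `K n` and so belong to the open set in question.
    refine exists_component_of_ultrafilter hJ hc hτ (fun s hs => h𝒰l (hlJ s hs))
      (K' := K (n + 1)) (C := F ⁻¹' C)
      ((hF.isOpen_inter_preimage hD (hU n)).sdiff (hK n).isClosed) (hK (n + 1))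
      ((hF.mono (hKD _)).preimage_isClosed_of_isClosed (hK _).isClosed hCc) ?_ ?_ ?_ (h𝒰K (n + 1))
    · exact fun t ht hτt htK => ⟨⟨hcD ht, hCU (hτC ⟨ht, hτt⟩)⟩, fun h => htK (hmono n.le_succ h)⟩
    · exact fun t ht hτt _ => hτC ⟨ht, hτt⟩
    · exact fun x hx hxi => ⟨⟨hKD _ hx.1, hCU hx.2⟩, fun h => hxi (hKi n h)⟩
  choose O hO1 hO2 hO3 hO4 using hO
  have hx : ∀ n, ∃ x, x ∈ O n ∧ x ∈ O (n + 1) := fun n => by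
    obtain ⟨t, ht⟩ := ((hO4 n).and (hO4 (n + 1))).exists
    exact ⟨c t, ht⟩
  choose x hx using hx
  exact ⟨x, O, fun n => ⟨hO1 n, hO2 n, fun y hy => (hO3 n hy).1.1, fun y hy => (hO3 n hy).1.2,
    disjoint_left.2 fun y hy => (hO3 n hy).2, (hx n).1, (hx n).2⟩⟩

/-! ### Smooth curves in open sets -/

section SmoothCurves

variable {E : Type*} [NormedAddCommGroup E] [NormedSpace ℝ E]

/-- Points of a connected open set are joined by smooth curves. -/
theorem IsPreconnected.exists_contDiff_curve {O : Set E} (hO : IsPreconnected O) (hO' : IsOpen O)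
    {x y : E} (hx : x ∈ O) (hy : y ∈ O) :
    ∃ γ : ℝ → E, ContDiff ℝ ∞ γ ∧ γ 0 = x ∧ γ 1 = y ∧ ∀ t ∈ Icc (0 : ℝ) 1, γ t ∈ O := by
  refine hO.induction₂' (fun x y => ∃ γ : ℝ → E, ContDiff ℝ ∞ γ ∧ γ 0 = x ∧ γ 1 = y ∧
    ∀ t ∈ Icc (0 : ℝ) 1, γ t ∈ O) ?_ ?_ hx hy
  · intro x hx
    obtain ⟨r, hr, hrO⟩ := Metric.isOpen_iff.1 hO' x hx
    have hseg : ∀ a ∈ Metric.ball x r, ∀ b ∈ Metric.ball x r, ∃ γ : ℝ → E, ContDiff ℝ ∞ γ ∧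
        γ 0 = a ∧ γ 1 = b ∧ ∀ t ∈ Icc (0 : ℝ) 1, γ t ∈ O := by
      intro a ha b hb
      refine ⟨fun t => a + t • (b - a), by fun_prop, by simp, by simp, fun t ht => hrO ?_⟩
      exact (convex_ball x r).add_smul_sub_mem ha hb ht
    filter_upwards [mem_nhdsWithin_of_mem_nhds (Metric.ball_mem_nhds x hr)] with y hy
    exact ⟨hseg x (Metric.mem_ball_self hr) y hy, hseg y hy x (Metric.mem_ball_self hr)⟩
  · rintro x y z - - - ⟨γ, hγ, hγ0, hγ1, hγO⟩ ⟨η, hη, hη0, hη1, hηO⟩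
    have hφ : ContDiff ℝ ∞ Real.smoothTransition := Real.smoothTransition.contDiff
    have hmem : ∀ t, Real.smoothTransition t ∈ Icc (0 : ℝ) 1 := fun t =>
      ⟨Real.smoothTransition.nonneg t, Real.smoothTransition.le_one t⟩
    -- For `t ≤ 1/2` the second summand is `y`, for `t ≥ 1/2` the first one is. The formula is thus
    -- the concatenation, and it is smooth without any gluing.
    refine ⟨fun t => γ (Real.smoothTransition (2 * t)) + η (Real.smoothTransition (2 * t - 1)) - y,
      by fun_prop, ?_, ?_, fun t ht => ?_⟩
    · simp [hγ0, hη0, Real.smoothTransition.zero_of_nonpos]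
    · norm_num
      simp [hγ1, hη1, Real.smoothTransition.one_of_one_le]
    · rcases le_total t (1 / 2) with h | h
      · have : Real.smoothTransition (2 * t - 1) = 0 :=
          Real.smoothTransition.zero_of_nonpos (by linarith)
        simpa [this, hη0] using hγO _ (hmem (2 * t))
      · have : Real.smoothTransition (2 * t) = 1 :=
          Real.smoothTransition.one_of_one_le (by linarith)
        simpa [this, hγ1] using hηO _ (hmem (2 * t - 1))

/-- A smooth curve running through a chain of connected open sets. -/
theorem exists_contDiff_curve_of_chain {x : ℕ → E} {O : ℕ → Set E} (hO : ∀ n, IsOpen (O n))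
    (hO' : ∀ n, IsPreconnected (O n)) (hx : ∀ n, x n ∈ O n) (hx' : ∀ n, x n ∈ O (n + 1)) :
    ∃ g : ℝ → E, ContDiff ℝ ∞ g ∧ ∀ n : ℕ, ∀ t ∈ Icc (n : ℝ) (n + 1), g t ∈ O (n + 1) := by
  have hφ : ContDiff ℝ ∞ Real.smoothTransition := Real.smoothTransition.contDiff
  have hγ : ∀ n, ∃ γ : ℝ → E, ContDiff ℝ ∞ γ ∧ γ 0 = x n ∧ γ 1 = x (n + 1) ∧
      ∀ t ∈ Icc (0 : ℝ) 1, γ t ∈ O (n + 1) := fun n =>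
    (hO' (n + 1)).exists_contDiff_curve (hO (n + 1)) (hx' n) (hx (n + 1))
  choose γ hγ hγ0 hγ1 hγO using hγ
  -- The `k`-th increment vanishes for `t ≤ k` and is constantly `x (k + 1) - x k` for `t ≥ k + 1`.
  -- The sums telescope, and for `t ≤ N` they no longer change after the index `N`, so the limit is
  -- smooth.
  set G : ℕ → ℝ → E := fun N t =>
    x 0 + ∑ k ∈ Finset.range N, (γ k (Real.smoothTransition (t - k)) - x k) with hG
  have hGs : ∀ N, ContDiff ℝ ∞ (G N) := fun N =>
    contDiff_const.add (ContDiff.sum fun k _ => ((hγ k).comp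
      (hφ.comp (contDiff_id.sub contDiff_const))).sub contDiff_const)
  have hstep : ∀ (N : ℕ) (t : ℝ), t ≤ N → G (N + 1) t = G N t := by
    intro N t ht
    simp only [hG, Finset.sum_range_succ]
    rw [Real.smoothTransition.zero_of_nonpos (by linarith), hγ0]
    simp
  have hstab : ∀ (N m : ℕ) (t : ℝ), t ≤ N → G (N + m) t = G N t := by
    intro N m t ht
    induction m with
    | zero => rfl
    | succ m ih =>
      rw [← ih, ← add_assoc]
      exact hstep _ _ (by push_cast; linarith [(Nat.cast_nonneg m : (0 : ℝ) ≤ m)])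
  have hval : ∀ (n : ℕ) (t : ℝ), (n : ℝ) ≤ t →
      G (n + 1) t = γ n (Real.smoothTransition (t - n)) := by
    intro n t ht
    have : ∀ k ∈ Finset.range n, γ k (Real.smoothTransition (t - k)) - x k = x (k + 1) - x k := by
      intro k hk
      have hk' : (k : ℝ) + 1 ≤ n := by exact_mod_cast Finset.mem_range.1 hk
      rw [Real.smoothTransition.one_of_one_le (by linarith), hγ1]
    simp only [hG, Finset.sum_range_succ]
    rw [Finset.sum_congr rfl this, Finset.sum_range_sub]
    abel
  have hglob : ∀ (N : ℕ) (t : ℝ), t ≤ N → G ⌈t⌉₊ t = G N t := by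
    intro N t ht
    obtain ⟨m, rfl⟩ := Nat.exists_eq_add_of_le (Nat.ceil_le.2 ht)
    exact (hstab _ m t (Nat.le_ceil t)).symm
  refine ⟨fun t => G ⌈t⌉₊ t, ?_, ?_⟩
  · rw [contDiff_iff_contDiffAt]
    intro t
    obtain ⟨N, hN⟩ := exists_nat_gt t
    refine (hGs N).contDiffAt.congr_of_eventuallyEq ?_
    filter_upwards [Iio_mem_nhds hN] with s hs using hglob N s (le_of_lt hs)
  · intro n t ht
    change G ⌈t⌉₊ t ∈ _
    rw [hglob (n + 1) t (by push_cast; exact ht.2), hval n t ht.1]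
    exact hγO n _ ⟨Real.smoothTransition.nonneg _, Real.smoothTransition.le_one _⟩

end SmoothCurves

/-! ### Weak properness and the continuation property of smooth maps -/

section WeaklyProper

/-- Continuity of `α` at `b` makes the image curve right-extendible. Any sequence of times tending
to `b` then has a subsequence along which `c` converges in the compact set. -/
theorem IsWeaklyProper.hasContinuationProperty {E : Type*} [NormedAddCommGroup E]
    {M : Type*} [TopologicalSpace M] {F : E → M} {D : Set E} (h : IsWeaklyProper F D)
    {P : Set (ℝ → M)} (hP : ∀ α ∈ P, ContinuousOn α (Icc 0 1)) :
    HasContinuationProperty F D P := by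
  intro α hα b hb hb1 c hc hcD hcα
  have hlim : Tendsto (F ∘ c) (𝓝[<] b) (𝓝 (α b)) := by
    have h1 : Tendsto α (𝓝[Ico 0 b] b) (𝓝 (α b)) :=
      (hP α hα b ⟨hb.le, hb1⟩).mono_left (nhdsWithin_mono _ fun t ht => ⟨ht.1, ht.2.le.trans hb1⟩)
    rw [nhdsWithin_Ico_eq_nhdsLT hb] at h1
    refine h1.congr' ?_
    filter_upwards [Ico_mem_nhdsLT hb] with t ht using (hcα ht).symm
  obtain ⟨K, hK, hKD, hcK⟩ := h.1 b hb c hc hcD ⟨_, hlim⟩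
  obtain ⟨u, -, hu, hub⟩ := exists_seq_strictMono_tendsto' hb
  obtain ⟨x, hx, φ, hφ, hlim⟩ := hK.tendsto_subseq (x := fun k => c (u k))
    fun k => hcK ⟨u k, ⟨(hu k).1.le, (hu k).2⟩, rfl⟩
  exact ⟨u ∘ φ, fun k => ⟨(hu _).1.le, (hu _).2⟩, hub.comp hφ.tendsto_atTop, x, hKD hx, hlim⟩

variable {E : Type*} [NormedAddCommGroup E] [NormedSpace ℝ E]
    {M : Type*} [TopologicalSpace M] [ChartedSpace E M]

/-- A curve in `D` running to infinity in `D`, along which `F` converges, contradicts the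
continuation property. -/
theorem HasContinuationProperty.not_escaping {F : E → M} {D : Set E}
    (h : HasContinuationProperty F D (piecewiseSmoothPaths E M))
    (hF : ContMDiffOn 𝓘(ℝ, E) 𝓘(ℝ, E) ∞ F D) {g : ℝ → E} (hg : ContDiff ℝ ∞ g)
    (hgD : ∀ t, 0 ≤ t → g t ∈ D) {q : M} (hq : Tendsto (F ∘ g) atTop (𝓝 q)) :
    ∃ x ∈ D, MapClusterPt x atTop g := by
  -- A smooth change of time from `[0, 1)` to `[0, ∞)`.
  set r : ℝ → ℝ := fun s => s / (1 - s) with hr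
  have hr0 : ∀ s ∈ Ico (0 : ℝ) 1, 0 ≤ r s := fun s hs => div_nonneg hs.1 (by linarith [hs.2])
  have hrs : ContDiffOn ℝ ∞ r (Iio 1) :=
    contDiffOn_id.div (contDiffOn_const.sub contDiffOn_id) fun s hs => by
      have : s < 1 := hs
      exact sub_ne_zero.2 this.ne'
  have hrlim : Tendsto r (𝓝[<] 1) atTop := by
    have h1 : Tendsto (fun s : ℝ => 1 - s) (𝓝[<] 1) (𝓝[>] 0) := by
      refine tendsto_nhdsWithin_iff.2 ⟨?_, ?_⟩
      · refine Tendsto.mono_left ?_ nhdsWithin_le_nhds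
        have : Continuous fun s : ℝ => 1 - s := by fun_prop
        simpa using this.tendsto 1
      · filter_upwards [self_mem_nhdsWithin] with s hs
        exact sub_pos.2 (mem_Iio.1 hs)
    have h2 : Tendsto (fun s : ℝ => s) (𝓝[<] 1) (𝓝 1) := nhdsWithin_le_nhds
    simpa [hr, div_eq_mul_inv] using h2.pos_mul_atTop one_pos (tendsto_inv_nhdsGT_zero.comp h1)
  have hgr : ContDiffOn ℝ ∞ (g ∘ r) (Iio 1) := hg.comp_contDiffOn hrs
  have hgrD : MapsTo (g ∘ r) (Ico 0 1) D := fun s hs => hgD _ (hr0 s hs)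
  set α : ℝ → M := fun s => if s < 1 then F (g (r s)) else q with hα
  have hαe : EqOn (F ∘ (g ∘ r)) α (Ico 0 1) := fun s hs => by simp [hα, hs.2]
  have hαs : ContMDiffOn 𝓘(ℝ, ℝ) 𝓘(ℝ, E) ∞ α (Ico 0 1) := by
    refine ContMDiffOn.congr ?_ (fun s hs => (hαe hs).symm)
    exact hF.comp ((hgr.mono fun s hs => hs.2).contMDiffOn) hgrD
  have hαlim : Tendsto α (𝓝[<] 1) (𝓝 q) := by
    refine (hq.comp hrlim).congr' ?_
    filter_upwards [Ico_mem_nhdsLT (zero_lt_one' ℝ)] with s hs using hαe hs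
  have hαP : α ∈ piecewiseSmoothPaths E M := by
    -- No break points are needed: smoothness can fail only at the end point `1`, where continuity
    -- suffices.
    refine ⟨fun s hs => ?_, ∅, by simp, fun s t hs hst ht _ =>
      hαs.mono fun x hx => ⟨hs.trans hx.1, hx.2.trans_lt ht⟩⟩
    rcases eq_or_lt_of_le hs.2 with rfl | h1
    · have hq1 : α 1 = q := by simp [hα]
      rw [← Ico_union_right (zero_le_one' ℝ), continuousWithinAt_union]
      refine ⟨?_, continuousWithinAt_singleton⟩
      rw [ContinuousWithinAt, nhdsWithin_Ico_eq_nhdsLT one_pos, hq1]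
      exact hαlim
    · refine (hαs.continuousOn s ⟨hs.1, h1⟩).mono_of_mem_nhdsWithin ?_
      filter_upwards [self_mem_nhdsWithin, mem_nhdsWithin_of_mem_nhds (Iio_mem_nhds h1)]
        with x hx hx1 using ⟨hx.1, hx1⟩
  obtain ⟨t, ht, ht1, x, hx, hlim⟩ := h α hαP 1 one_pos le_rfl (g ∘ r)
    (hgr.continuousOn.mono fun s hs => hs.2) hgrD hαe
  refine ⟨x, hx, ?_⟩
  have ht' : Tendsto t atTop (𝓝[<] 1) :=
    tendsto_nhdsWithin_iff.2 ⟨ht1, Eventually.of_forall fun k => (ht k).2⟩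
  exact (Tendsto.mapClusterPt hlim).of_comp (hrlim.comp ht')

/-- A smooth map on an open subset `D` of a finite-dimensional space is weakly proper if it has the
continuation property for piecewise smooth paths. -/
theorem HasContinuationProperty.isWeaklyProper [FiniteDimensional ℝ E]
    [RegularSpace M] [FirstCountableTopology M] {F : E → M} {D : Set E} (hD : IsOpen D)
    (hF : ContMDiffOn 𝓘(ℝ, E) 𝓘(ℝ, E) ∞ F D)
    (h : HasContinuationProperty F D (piecewiseSmoothPaths E M)) :
    IsWeaklyProper F D := by
  have : ProperSpace E := FiniteDimensional.proper ℝ E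
  obtain ⟨K, hK, hKD, hKi, hKu⟩ := hD.exists_compact_exhaustion
  have hmono : Monotone K := monotone_nat_of_le_succ fun n => (hKi n).trans interior_subset
  -- Describing `l` as the filter of tails of `J` treats finite and infinite `a` at once.
  have key : ∀ (J : Set ℝ) (l : Filter ℝ) [l.NeBot], J.OrdConnected → IsLeast J 0 →
      (∀ s, s ∈ l ↔ ∃ τ ∈ J, J ∩ Ici τ ⊆ s) → ExtendibleImageInCompact F D J l := by
    intro J l _ hJ h0 hl c hc hcD ⟨q, hq⟩
    by_contra hnot
    obtain ⟨U, hU⟩ := (𝓝 q).exists_antitone_basis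
    obtain ⟨x, O, hxO⟩ := exists_chain_of_not_compact hD hF.continuousOn hK hKD hKi hJ h0 hl hc hcD
      hq hnot (U := fun n => interior (U n)) (fun n => isOpen_interior)
      (fun n => mem_interior_iff_mem_nhds.2 (hU.mem n))
    choose hO1 hO2 hO3 hO4 hO5 hO6 hO7 using hxO
    obtain ⟨g, hg, hgO⟩ := exists_contDiff_curve_of_chain hO1 hO2 hO6 hO7
    have hfloor : ∀ t : ℝ, 0 ≤ t → g t ∈ O (⌊t⌋₊ + 1) := fun t ht =>
      hgO _ t ⟨Nat.floor_le ht, (Nat.lt_floor_add_one t).le⟩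
    obtain ⟨x, hx, hcl⟩ := h.not_escaping hF hg (fun t ht => hO3 _ (hfloor t ht)) (q := q) (by
      refine hU.1.tendsto_right_iff.2 fun n _ => ?_
      filter_upwards [eventually_ge_atTop (n : ℝ)] with t ht
      have h0t : (0 : ℝ) ≤ t := n.cast_nonneg.trans ht
      exact hU.2 ((Nat.le_floor ht).trans (Nat.le_succ _))
        (interior_subset (hO4 _ _ (hfloor t h0t))))
    obtain ⟨n, hn⟩ := hKu x hx
    -- Near the cluster point, `g` is in `K (n + 1)` at arbitrarily late times. But for `t ≥ n` the
    -- point `g t` lies in `O (⌊t⌋₊ + 1)`, which is disjoint from `K (⌊t⌋₊ + 1) ⊇ K (n + 1)`.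
    have hfr := mapClusterPt_iff_frequently.1 hcl _ (isOpen_interior.mem_nhds (hKi n hn))
    obtain ⟨t, ht, htn⟩ := (hfr.and_eventually (eventually_ge_atTop (n : ℝ))).exists
    have h0t : (0 : ℝ) ≤ t := n.cast_nonneg.trans htn
    exact disjoint_left.1 (hO5 _) (hfloor t h0t)
      (hmono (Nat.succ_le_succ (Nat.le_floor htn)) (interior_subset ht))
  refine ⟨fun a ha => key _ _ ordConnected_Ico (isLeast_Ico ha) fun s => ?_,
    key _ _ ordConnected_Ici isLeast_Ici fun s => ?_⟩
  · have hI : ∀ τ ∈ Ico 0 a, Ico 0 a ∩ Ici τ = Ico τ a := fun τ hτ => by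
      ext t
      exact ⟨fun h => ⟨h.2, h.1.2⟩, fun h => ⟨⟨hτ.1.trans h.1, h.2⟩, h.1⟩⟩
    constructor
    · intro hs
      obtain ⟨τ, hτ, hτs⟩ := mem_nhdsLT_iff_exists_Ico_subset.1 hs
      have hm : max τ 0 ∈ Ico 0 a := ⟨le_max_right _ _, max_lt hτ ha⟩
      exact ⟨max τ 0, hm, (hI _ hm).subset.trans ((Ico_subset_Ico_left (le_max_left _ _)).trans hτs)⟩
    · rintro ⟨τ, hτ, hτs⟩
      exact mem_of_superset (Ico_mem_nhdsLT hτ.2) ((hI τ hτ).superset.trans hτs)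
  · rw [mem_atTop_sets]
    constructor
    · rintro ⟨τ, hτ⟩
      exact ⟨max τ 0, mem_Ici.2 (le_max_right _ _), fun t ht => hτ t ((le_max_left _ _).trans ht.2)⟩
    · rintro ⟨τ, hτ, hs⟩
      exact ⟨τ, fun t ht => hs ⟨le_trans hτ ht, ht⟩⟩

end WeaklyProper

/-! ### Composition with a smooth map is smooth on spaces of continuous maps -/

section Postcomp

universe u

variable {X : Type*} [TopologicalSpace X] [CompactSpace X]
  {E F G : Type u} [NormedAddCommGroup E] [NormedSpace ℝ E] [NormedAddCommGroup F] [NormedSpace ℝ F]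
  [NormedAddCommGroup G] [NormedSpace ℝ G]

/-- The pointwise application of a bilinear map to continuous maps. -/
noncomputable def ContinuousMap.pointwiseCLM (X : Type*) [TopologicalSpace X] [CompactSpace X]
    (B : G →L[ℝ] E →L[ℝ] F) : C(X, G) →L[ℝ] C(X, E) →L[ℝ] C(X, F) :=
  LinearMap.mkContinuous₂
    (LinearMap.mk₂ ℝ (fun (A : C(X, G)) (h : C(X, E)) =>
        (⟨fun k => B (A k) (h k), (B.continuous.comp A.continuous).clm_apply h.continuous⟩ :
          C(X, F)))
      (fun A B h => by ext; simp) (fun c A h => by ext; simp)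
      (fun A h h' => by ext; simp) (fun c A h => by ext; simp)) ‖B‖
    (fun A h => by
      refine (ContinuousMap.norm_le _ (by positivity)).2 fun k => ?_
      refine (B.le_opNorm₂ (A k) (h k)).trans ?_
      gcongr
      · exact A.norm_coe_le_norm k
      · exact h.norm_coe_le_norm k)

/-- By the mean value inequality on the segment from `y k` to `y k + h k`, the remainder is
controlled by the oscillation of `g'` there. This is small uniformly in `k` because `u ↦ g'.comp u`
is continuous in the sup norm. -/
theorem ContinuousMap.hasFDerivAt_postcomp (B : G →L[ℝ] E →L[ℝ] F) {g : C(E, F)} {g' : C(E, G)}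
    (hg : ∀ x, HasFDerivAt g (B (g' x)) x) (y : C(X, E)) :
    HasFDerivAt (fun u : C(X, E) => g.comp u) (ContinuousMap.pointwiseCLM X B (g'.comp y)) y := by
  rw [hasFDerivAt_iff_isLittleO_nhds_zero, Asymptotics.isLittleO_iff]
  intro ε hε
  have hcont : Continuous fun u : C(X, E) => g'.comp u := ContinuousMap.continuous_postcomp g'
  have hB : 0 < ‖B‖ + 1 := by positivity
  obtain ⟨δ, hδ, hδε⟩ := Metric.continuousAt_iff.1 (hcont.continuousAt (x := y)) (ε / (‖B‖ + 1))
    (by positivity)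
  filter_upwards [Metric.ball_mem_nhds (0 : C(X, E)) hδ] with h hh
  rw [mem_ball_zero_iff] at hh
  refine (ContinuousMap.norm_le _ (by positivity)).2 fun k => ?_
  have hseg : ∀ z ∈ segment ℝ (y k) (y k + h k), ‖B (g' z) - B (g' (y k))‖ ≤ ε := by
    intro z hz
    rw [segment_eq_image'] at hz
    obtain ⟨s, hs, rfl⟩ := hz
    have h1 : dist (y + s • h) y < δ := by
      rw [dist_eq_norm, add_sub_cancel_left, norm_smul, Real.norm_of_nonneg hs.1]
      exact (mul_le_of_le_one_left (norm_nonneg _) hs.2).trans_lt hh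
    have h2 : ‖g' (y k + s • h k) - g' (y k)‖ ≤ ε / (‖B‖ + 1) :=
      ((g'.comp (y + s • h) - g'.comp y).norm_coe_le_norm k).trans
        (le_of_lt (by simpa only [dist_eq_norm] using hδε h1))
    rw [add_sub_cancel_left, ← map_sub]
    refine (B.le_opNorm _).trans ((mul_le_mul (lt_add_one ‖B‖).le h2 (norm_nonneg _)
      hB.le).trans_eq ?_)
    field_simp
  have h3 := (convex_segment (y k) (y k + h k)).norm_image_sub_le_of_norm_hasFDerivWithin_le'
    (fun z _ => (hg z).hasFDerivWithinAt) hseg (left_mem_segment ℝ _ _) (right_mem_segment ℝ _ _)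
  rw [add_sub_cancel_left] at h3
  exact h3.trans (mul_le_mul_of_nonneg_left (h.norm_coe_le_norm k) hε.le)

theorem ContinuousMap.contDiff_succ_postcomp (B : G →L[ℝ] E →L[ℝ] F) {g : C(E, F)} {g' : C(E, G)}
    (hg : ∀ x, HasFDerivAt g (B (g' x)) x) {n : ℕ}
    (h : ContDiff ℝ n fun u : C(X, E) => g'.comp u) :
    ContDiff ℝ (n + 1 : ℕ) fun u : C(X, E) => g.comp u := by
  push_cast
  exact contDiff_succ_iff_hasFDerivAt.2 ⟨fun u => ContinuousMap.pointwiseCLM X B (g'.comp u),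
    (ContinuousMap.pointwiseCLM X B).contDiff.comp h, ContinuousMap.hasFDerivAt_postcomp B hg⟩

/-- Induction on the order of differentiability: the derivative is again a postcomposition, with
`fderiv ℝ g`, followed by a continuous linear map. The target changes to `E →L[ℝ] F`, hence the
generalization over `F` and the common universe. -/
theorem ContinuousMap.contDiff_postcomp (g : C(E, F)) (hg : ContDiff ℝ ∞ g) :
    ContDiff ℝ ∞ fun u : C(X, E) => g.comp u := by
  rw [contDiff_infty]
  intro n
  induction n generalizing F with
  | zero => exact contDiff_zero.2 (ContinuousMap.continuous_postcomp g)
  | succ n ih =>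
    exact ContinuousMap.contDiff_succ_postcomp (ContinuousLinearMap.id ℝ (E →L[ℝ] F))
      (g' := ⟨fderiv ℝ g, hg.continuous_fderiv (by simp)⟩)
      (fun x => (hg.differentiable (by simp) x).hasFDerivAt)
      (ih _ (contDiff_infty_iff_fderiv.1 hg).2)

end Postcomp

/-! ### The inverse function theorem for smooth maps -/

/-- The local inverse in the inverse function theorem is smooth on a neighborhood. -/
theorem ContDiff.exists_local_right_inverse {E F : Type*} [NormedAddCommGroup E] [NormedSpace ℝ E]
    [CompleteSpace E] [NormedAddCommGroup F] [NormedSpace ℝ F] {H : E → F} (hH : ContDiff ℝ ∞ H)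
    {a : E} {A : E ≃L[ℝ] F} (hA : HasFDerivAt H (A : E →L[ℝ] F) a) :
    ∃ (W : Set F) (G : F → E), IsOpen W ∧ H a ∈ W ∧ ContDiffOn ℝ ∞ G W ∧ G (H a) = a ∧
      ∀ w ∈ W, H (G w) = w := by
  have hn : (∞ : WithTop ℕ∞) ≠ 0 := by simp
  let e := hH.contDiffAt.toOpenPartialHomeomorph H hA hn
  have he : ∀ x, e x = H x := fun x => rfl
  have hae : a ∈ e.source := hH.contDiffAt.mem_toOpenPartialHomeomorph_source hA hn
  -- Smoothness of the inverse at a point needs an invertible derivative there; invertibility is an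
  -- open condition, so it persists near `a`.
  have hS : IsOpen {x | fderiv ℝ H x ∈ range ((↑) : (E ≃L[ℝ] F) → E →L[ℝ] F)} :=
    ContinuousLinearEquiv.isOpen.preimage (hH.continuous_fderiv hn)
  refine ⟨e.target ∩ e.symm ⁻¹' {x | fderiv ℝ H x ∈ range ((↑) : (E ≃L[ℝ] F) → E →L[ℝ] F)}, e.symm,
    e.isOpen_inter_preimage_symm hS, ⟨e.map_source hae, ?_⟩, fun w hw => ?_, e.left_inv hae,
    fun w hw => e.right_inv hw.1⟩
  · have : e.symm (H a) = a := e.left_inv hae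
    rw [mem_preimage, this, mem_ofPred_eq, hA.fderiv]
    exact mem_range_self A
  · obtain ⟨A', hA'⟩ := hw.2
    refine (e.contDiffAt_symm (f₀' := A') hw.1 ?_ hH.contDiffAt).contDiffWithinAt
    rw [hA']
    exact (hH.differentiable hn _).hasFDerivAt

/-! ### Smooth dependence of solutions of ODEs on the initial condition -/

section Flow

universe u
variable {E : Type u} [NormedAddCommGroup E] [NormedSpace ℝ E]

/-- The primitive vanishing at `0` of a continuous function on `[-1, 1]`. -/
noncomputable def primitiveCLM (E : Type u) [NormedAddCommGroup E] [NormedSpace ℝ E] :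
    C(Icc (-1 : ℝ) 1, E) →L[ℝ] C(Icc (-1 : ℝ) 1, E) :=
  LinearMap.mkContinuous
    { toFun := fun u => ⟨fun s => ∫ r in (0 : ℝ)..s, IccExtend (by norm_num) u r,
        (intervalIntegral.continuous_primitive (fun a b => (u.continuous.Icc_extend'
          (h := by norm_num)).intervalIntegrable a b) 0).comp continuous_subtype_val⟩
      map_add' := fun u v => by
        ext s
        exact intervalIntegral.integral_add
          ((u.continuous.Icc_extend' (h := by norm_num)).intervalIntegrable _ _)
          ((v.continuous.Icc_extend' (h := by norm_num)).intervalIntegrable _ _)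
      map_smul' := fun c u => by
        ext s
        exact intervalIntegral.integral_smul c _ }
    1 (fun u => by
      refine (ContinuousMap.norm_le _ (by positivity)).2 fun s => ?_
      refine (intervalIntegral.norm_integral_le_of_norm_le_const (C := ‖u‖)
        fun r _ => u.norm_coe_le_norm _).trans ?_
      rw [one_mul, sub_zero]
      exact mul_le_of_le_one_right (norm_nonneg _) (abs_le.2 s.2))

/-- A family of curves on `[-1, 1]`, depending smoothly on `(τ, x)`, which start in `x` and whose
velocity is `τ f`. -/
theorem exists_smooth_rescaled_flow [CompleteSpace E] {f : E → E} (hf : ContDiff ℝ ∞ f) (x₀ : E) :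
    ∃ (W : Set (ℝ × E)) (U : ℝ × E → C(Icc (-1 : ℝ) 1, E)), IsOpen W ∧ (0, x₀) ∈ W ∧
      ContDiffOn ℝ ∞ U W ∧ U (0, x₀) = ContinuousMap.const _ x₀ ∧
      ∀ w ∈ W, ∀ s, U w s = w.2 + w.1 • ∫ r in (0 : ℝ)..s, f (IccExtend (by norm_num) (U w) r) := by
  let X := C(Icc (-1 : ℝ) 1, E)
  let fc : C(E, E) := ⟨f, hf.continuous⟩
  let Q : X → X := fun u => primitiveCLM E (fc.comp u)
  have hQ : ContDiff ℝ ∞ Q :=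
    (primitiveCLM E).contDiff.comp (ContinuousMap.contDiff_postcomp fc hf)
  -- With a constant function `x` on the right, `H (τ, u) = (τ, x)` is the integral equation `u = x
  -- + τ ∫ f ∘ u`. At `τ = 0` and `u = k` the derivative of `H` is a shear, hence invertible without
  -- any bound on `f`.
  let H : ℝ × X → ℝ × X := fun p => (p.1, p.2 - p.1 • Q p.2)
  have hH : ContDiff ℝ ∞ H :=
    contDiff_fst.prodMk (contDiff_snd.sub (contDiff_fst.smul (hQ.comp contDiff_snd)))
  let k : C(Icc (-1 : ℝ) 1, E) := ContinuousMap.const _ x₀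
  let B : ℝ →L[ℝ] X := (ContinuousLinearMap.id ℝ ℝ).smulRight (Q k)
  let A : (ℝ × X) ≃L[ℝ] (ℝ × X) := ContinuousLinearEquiv.equivOfInverse
    ((ContinuousLinearMap.fst ℝ ℝ X).prod
      (ContinuousLinearMap.snd ℝ ℝ X - B.comp (ContinuousLinearMap.fst ℝ ℝ X)))
    ((ContinuousLinearMap.fst ℝ ℝ X).prod
      (ContinuousLinearMap.snd ℝ ℝ X + B.comp (ContinuousLinearMap.fst ℝ ℝ X)))
    (fun p => by ext <;> simp) (fun p => by ext <;> simp)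
  have hA : HasFDerivAt H (A : (ℝ × X) →L[ℝ] (ℝ × X)) (0, k) := by
    have h1 : HasFDerivAt (fun p : ℝ × X => p.1) (ContinuousLinearMap.fst ℝ ℝ X) (0, k) :=
      hasFDerivAt_fst
    have h2 : HasFDerivAt (fun p : ℝ × X => p.2) (ContinuousLinearMap.snd ℝ ℝ X) (0, k) :=
      hasFDerivAt_snd
    have h3 : HasFDerivAt (fun p : ℝ × X => Q p.2) _ (0, k) :=
      ((hQ.differentiable (by simp) _).hasFDerivAt).comp (0, k) h2
    refine (h1.prodMk (h2.sub (h1.smul h3))).congr_fderiv ?_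
    ext p <;> simp [A, B]
  obtain ⟨W, G, hW, hkW, hG, hGk, hHG⟩ := hH.exists_local_right_inverse hA
  have hHk : H (0, k) = (0, k) := by simp [H]
  rw [hHk] at hkW hGk
  let ι : ℝ × E → ℝ × X := fun p => (p.1, ContinuousLinearMap.const ℝ (Icc (-1 : ℝ) 1) p.2)
  have hι : ContDiff ℝ ∞ ι := contDiff_fst.prodMk
    ((ContinuousLinearMap.const ℝ (Icc (-1 : ℝ) 1) (M := E)).contDiff.comp contDiff_snd)
  refine ⟨ι ⁻¹' W, fun p => (G (ι p)).2, hW.preimage hι.continuous, hkW, ?_, ?_, ?_⟩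
  · exact contDiff_snd.comp_contDiffOn (hG.comp hι.contDiffOn (mapsTo_preimage _ _))
  · change (G (0, k)).2 = k
    rw [hGk]
  · intro w hw s
    have h1 := hHG _ hw
    have h2 : (G (ι w)).1 = w.1 := congrArg Prod.fst h1
    have h3 : (G (ι w)).2 - (G (ι w)).1 • Q (G (ι w)).2 = (ι w).2 := congrArg Prod.snd h1
    rw [h2, sub_eq_iff_eq_add] at h3
    exact congrArg (fun u : X => u s) h3

/-- The local flow of a globally defined smooth vector field on a Banach space. -/
theorem exists_smooth_flow_of_contDiff [CompleteSpace E] {f : E → E} (hf : ContDiff ℝ ∞ f) (x₀ : E)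
    {N : Set E} (hN : N ∈ 𝓝 x₀) :
    ∃ ε > 0, ∃ (W : Set E) (Z : E → ℝ → E), IsOpen W ∧ x₀ ∈ W ∧
      (∀ x ∈ W, Z x 0 = x ∧ ∀ t ∈ Ioo (-ε) ε, Z x t ∈ N ∧ HasDerivAt (Z x) (f (Z x t)) t) ∧
      ∀ t, ContDiffOn ℝ ∞ (fun x => Z x t) W := by
  obtain ⟨W, U, hW, h0W, hU, hU0, hUeq⟩ := exists_smooth_rescaled_flow hf x₀
  obtain ⟨δ, hδ, hδN⟩ := Metric.mem_nhds_iff.1 hN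
  have hcont : ContinuousAt U (0, x₀) := hU.continuousOn.continuousAt (hW.mem_nhds h0W)
  have hnear := (Metric.continuousAt_iff'.1 hcont δ hδ).and (hW.mem_nhds h0W)
  rw [nhds_prod_eq] at hnear
  obtain ⟨P, hP, R, hR, hPR⟩ := eventually_prod_iff.1 hnear
  obtain ⟨ε, hε, hεP⟩ := Metric.eventually_nhds_iff.1 hP
  have hPε : P (ε / 2) := hεP (by rw [Real.dist_eq, sub_zero, abs_of_pos] <;> linarith)
  obtain ⟨V, hVR, hV, hxV⟩ := eventually_nhds_iff.1 hR
  have hε2 : 0 < ε / 2 := by linarith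
  -- With `τ = ε / 2` fixed, evaluation at time `t / τ` turns the velocity `τ f` into `f`.
  refine ⟨ε / 2, hε2, V, fun x t => IccExtend (by norm_num) (U (ε / 2, x)) (t / (ε / 2)), hV, hxV,
    fun x hx => ?_, fun t => ?_⟩
  · obtain ⟨h1, h2⟩ := hPR hPε (hVR x hx)
    have hval : ∀ r ∈ Icc (-1 : ℝ) 1, IccExtend (by norm_num) (U (ε / 2, x)) r =
        x + (ε / 2) • ∫ r in (0 : ℝ)..r, f (IccExtend (by norm_num) (U (ε / 2, x)) r) := by
      intro r hr
      rw [IccExtend_of_mem _ _ hr]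
      exact hUeq _ h2 ⟨r, hr⟩
    have hcf : Continuous fun r => f (IccExtend (by norm_num) (U (ε / 2, x)) r) :=
      hf.continuous.comp ((U (ε / 2, x)).continuous.Icc_extend' (h := by norm_num))
    refine ⟨?_, fun t ht => ⟨hδN ?_, ?_⟩⟩
    · dsimp only
      rw [zero_div, hval 0 (by norm_num)]
      simp
    · refine (lt_of_le_of_lt ?_ h1 : dist _ x₀ < δ)
      rw [hU0]
      exact (ContinuousMap.dist_apply_le_dist (f := U (ε / 2, x))
        (g := ContinuousMap.const _ x₀) (projIcc (-1) 1 (by norm_num) (t / (ε / 2))))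
    · have hmem : ∀ᶠ r in 𝓝 t, r / (ε / 2) ∈ Icc (-1 : ℝ) 1 := by
        filter_upwards [isOpen_Ioo.mem_nhds ht] with r hr
        rw [mem_Icc, le_div_iff₀ hε2, div_le_iff₀ hε2]
        constructor <;> linarith [hr.1, hr.2]
      have hd : HasDerivAt (fun r : ℝ => r / (ε / 2)) (1 / (ε / 2)) t := (hasDerivAt_id t).div_const _
      have hint := intervalIntegral.integral_hasDerivAt_right
        (hcf.intervalIntegrable 0 (t / (ε / 2)))
        (hcf.stronglyMeasurableAtFilter _ _) hcf.continuousAt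
      have hder := ((hint.scomp t hd).const_smul (ε / 2)).const_add x
      rw [smul_smul, mul_one_div_cancel hε2.ne', one_smul] at hder
      exact hder.congr_of_eventuallyEq (hmem.mono fun r hr => hval _ hr)
  · let ev : C(Icc (-1 : ℝ) 1, E) →L[ℝ] E :=
      ContinuousMap.evalCLM ℝ (projIcc (-1) 1 (by norm_num) (t / (ε / 2)))
    exact ev.contDiff.comp_contDiffOn (hU.comp (contDiff_const.prodMk contDiff_id).contDiffOn
      fun x hx => (hPR hPε (hVR x hx)).2)

/-- The local flow of a smooth vector field on an open subset of a finite-dimensional space. -/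
theorem exists_smooth_flow [FiniteDimensional ℝ E] {f : E → E} {Ω : Set E} (hΩ : IsOpen Ω)
    (hf : ContDiffOn ℝ ∞ f Ω) {x₀ : E} (hx₀ : x₀ ∈ Ω) :
    ∃ ε > 0, ∃ (W : Set E) (Z : E → ℝ → E), IsOpen W ∧ x₀ ∈ W ∧
      (∀ x ∈ W, Z x 0 = x ∧ ∀ t ∈ Ioo (-ε) ε, Z x t ∈ Ω ∧ HasDerivAt (Z x) (f (Z x t)) t) ∧
      ∀ t, ContDiffOn ℝ ∞ (fun x => Z x t) W := by
  have : CompleteSpace E := FiniteDimensional.complete ℝ E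
  obtain ⟨δ, hδ, hδΩ⟩ := Metric.isOpen_iff.1 hΩ x₀ hx₀
  -- The cut-off field `χ f` is smooth on all of `E`. Its flow is kept in the ball of radius `δ /
  -- 4`, where `χ = 1`, and so solves the original equation.
  let χ : ContDiffBump x₀ := ⟨δ / 4, δ / 2, by linarith, by linarith⟩
  have hsupp : tsupport χ ⊆ Ω := by
    rw [χ.tsupport_eq]
    exact (Metric.closedBall_subset_ball (by change δ / 2 < δ; linarith)).trans hδΩ
  have hχf : ContDiff ℝ ∞ fun x => χ x • f x := by
    rw [contDiff_iff_contDiffAt]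
    intro x
    by_cases hx : x ∈ tsupport χ
    · exact χ.contDiffAt.smul (hf.contDiffAt (hΩ.mem_nhds (hsupp hx)))
    · refine (contDiffAt_const (c := (0 : E))).congr_of_eventuallyEq ?_
      filter_upwards [(isClosed_tsupport χ).isOpen_compl.mem_nhds hx] with y hy
      rw [image_eq_zero_of_notMem_tsupport hy, zero_smul]
  have hN : Metric.closedBall x₀ (δ / 4) ∈ 𝓝 x₀ := Metric.closedBall_mem_nhds _ (by linarith)
  obtain ⟨ε, hε, W, Z, hW, hxW, hZ, hZs⟩ := exists_smooth_flow_of_contDiff hχf x₀ hN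
  refine ⟨ε, hε, W, Z, hW, hxW, fun x hx => ⟨(hZ x hx).1, fun t ht => ?_⟩, hZs⟩
  obtain ⟨h1, h2⟩ := (hZ x hx).2 t ht
  refine ⟨hδΩ (Metric.closedBall_subset_ball (by linarith) h1), ?_⟩
  rwa [χ.one_of_mem_closedBall h1, one_smul] at h2

end Flow

/-! ### Connections in local frames -/

section LocalFrame

open Bundle

variable {E : Type*} [NormedAddCommGroup E] [NormedSpace ℝ E]
    {M : Type*} [TopologicalSpace M] [ChartedSpace E M]

/-- The trivialization of the tangent bundle given by the preferred chart at `q`. -/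
noncomputable abbrev tangentTriv (E : Type*) [NormedAddCommGroup E] [NormedSpace ℝ E]
    {M : Type*} [TopologicalSpace M] [ChartedSpace E M] [IsManifold 𝓘(ℝ, E) 1 M] (q : M) :
    Trivialization E (π E (TangentSpace 𝓘(ℝ, E) : M → Type _)) :=
  trivializationAt E (TangentSpace 𝓘(ℝ, E)) q

/-- The vector field with coefficients `g` in the frame of the preferred chart at `q`. -/
noncomputable def frameSection [IsManifold 𝓘(ℝ, E) 1 M] (q : M) (g : M → E) (x : M) :
    TangentSpace 𝓘(ℝ, E) x :=
  (tangentTriv E q).symmL ℝ x (g x)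

variable [IsManifold 𝓘(ℝ, E) ∞ M]

theorem tangentTriv_frameSection {q x : M} (hx : x ∈ (chartAt E q).source) (g : M → E) :
    (tangentTriv E q ⟨x, frameSection q g x⟩).2 = g x := by
  have hx' : x ∈ (tangentTriv E q).baseSet := hx
  rw [← Trivialization.continuousLinearMapAt_apply_of_mem ℝ _ hx']
  exact Trivialization.continuousLinearMapAt_symmL _ hx' _

theorem mdifferentiableAt_frameSection {q x : M} (hx : x ∈ (chartAt E q).source) {g : M → E}
    (hg : MDifferentiableAt 𝓘(ℝ, E) 𝓘(ℝ, E) g x) :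
    MDifferentiableAt 𝓘(ℝ, E) (𝓘(ℝ, E).prod 𝓘(ℝ, E))
      (fun y => TotalSpace.mk' E y (frameSection q g y)) x := by
  refine ((tangentTriv E q).mdifferentiableAt_section_iff 𝓘(ℝ, E) _ hx).2 ?_
  refine hg.congr_of_eventuallyEq ?_
  filter_upwards [(chartAt E q).open_source.mem_nhds hx] with y hy
  exact tangentTriv_frameSection hy g

/-- The velocity of a curve in a chart. -/
theorem tangentTriv_velocity {q : M} {γ : ℝ → M} {t : ℝ}
    (hγ : MDifferentiableAt 𝓘(ℝ, ℝ) 𝓘(ℝ, E) γ t) (ht : γ t ∈ (chartAt E q).source) :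
    (tangentTriv E q ⟨γ t, velocity E γ t⟩).2 = deriv (chartAt E q ∘ γ) t := by
  have ht' : γ t ∈ (tangentTriv E q).baseSet := ht
  rw [← Trivialization.continuousLinearMapAt_apply_of_mem ℝ _ ht',
    TangentBundle.continuousLinearMapAt_trivializationAt ht]
  have h1 : MDifferentiableAt 𝓘(ℝ, E) 𝓘(ℝ, E) (extChartAt 𝓘(ℝ, E) q) (γ t) :=
    mdifferentiableAt_extChartAt ht
  have h2 := mfderiv_comp t h1 hγ
  rw [mfderiv_eq_fderiv] at h2
  have h3 := congrArg (fun A => A (1 : ℝ)) h2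
  refine h3.symm.trans ?_
  have h4 : (extChartAt 𝓘(ℝ, E) q ∘ γ) = chartAt E q ∘ γ := by
    funext s; simp [mfld_simps]
  rw [h4]
  rfl

variable (cov : CovariantDerivative 𝓘(ℝ, E) E (TangentSpace 𝓘(ℝ, E) : M → Type _))

theorem CovariantDerivative.sum_apply {ι : Type*} (s : Finset ι)
    {σ : ι → ∀ x : M, TangentSpace 𝓘(ℝ, E) x} {x : M}
    (hσ : ∀ i ∈ s, MDifferentiableAt 𝓘(ℝ, E) (𝓘(ℝ, E).prod 𝓘(ℝ, E))
      (fun y => TotalSpace.mk' E y (σ i y)) x) :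
    cov (∑ i ∈ s, σ i) x = ∑ i ∈ s, cov (σ i) x := by
  classical
  induction s using Finset.induction_on with
  | empty => simp
  | insert i s hi ih =>
    rw [Finset.sum_insert hi, Finset.sum_insert hi]
    have h1 := hσ i (Finset.mem_insert_self i s)
    have h2 : ∀ j ∈ s, _ := fun j hj => hσ j (Finset.mem_insert_of_mem hj)
    rw [← ih h2]
    refine cov.isCovariantDerivativeOnUniv.add h1 ?_
    have h3 := MDifferentiableAt.sum_section (s := s) h2
    convert! h3 using 3
    simp

variable [FiniteDimensional ℝ E]

/-- The Leibniz rule in a local frame. -/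
theorem CovariantDerivative.frameSection_apply {q x : M} (hx : x ∈ (chartAt E q).source)
    {g : M → E} (hg : MDifferentiableAt 𝓘(ℝ, E) 𝓘(ℝ, E) g x) (u : TangentSpace 𝓘(ℝ, E) x) :
    cov (frameSection q g) x u =
      ∑ i, (Module.finBasis ℝ E).repr (g x) i •
        cov (frameSection q fun _ => Module.finBasis ℝ E i) x u
      + (tangentTriv E q).symmL ℝ x (mfderiv 𝓘(ℝ, E) 𝓘(ℝ, E) g x u) := by
  set b := Module.finBasis ℝ E
  let l : Fin (Module.finrank ℝ E) → E →L[ℝ] ℝ := fun i => (b.coord i).toContinuousLinearMap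
  have hl : ∀ i, MDifferentiableAt 𝓘(ℝ, E) 𝓘(ℝ, ℝ) (fun y => l i (g y)) x := fun i =>
    ((l i).mdifferentiableAt (x := g x)).comp x hg
  have hdl : ∀ i, mfderiv 𝓘(ℝ, E) 𝓘(ℝ, ℝ) (fun y => l i (g y)) x u =
      l i (mfderiv 𝓘(ℝ, E) 𝓘(ℝ, E) g x u) := by
    intro i
    have h1 := mfderiv_comp x ((l i).mdifferentiableAt (x := g x)) hg
    have h2 : mfderiv 𝓘(ℝ, E) 𝓘(ℝ, ℝ) (l i) (g x) = l i := (l i).mfderiv_eq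
    rw [h2] at h1
    exact congrArg (fun A => A u) h1
  have hconst : ∀ i, MDifferentiableAt 𝓘(ℝ, E) (𝓘(ℝ, E).prod 𝓘(ℝ, E))
      (fun y => TotalSpace.mk' E y (frameSection q (fun _ => b i) y)) x := fun i =>
    mdifferentiableAt_frameSection hx mdifferentiableAt_const
  have hdecomp : frameSection q g =
      ∑ i, (fun y => l i (g y)) • (frameSection q fun _ => b i) := by
    funext y
    rw [Finset.sum_apply]
    simp only [frameSection, Pi.smul_apply', ← map_smul, ← map_sum]
    congr 1
    exact (b.sum_repr (g y)).symm
  rw [hdecomp, cov.sum_apply Finset.univ fun i _ => (hl i).smul_section (hconst i)]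
  have hleib : ∀ i, cov ((fun y => l i (g y)) • (frameSection q fun _ => b i)) x u =
      b.repr (g x) i • cov (frameSection q fun _ => b i) x u +
        (tangentTriv E q).symmL ℝ x (l i (mfderiv 𝓘(ℝ, E) 𝓘(ℝ, E) g x u) • b i) := by
    intro i
    rw [cov.isCovariantDerivativeOnUniv.leibniz (hconst i) (hl i)]
    have h4 : mvfderiv 𝓘(ℝ, E) (fun y => l i (g y)) x u =
      l i (mfderiv 𝓘(ℝ, E) 𝓘(ℝ, E) g x u) := hdl i
    simp only [add_apply, smul_apply,
      ContinuousLinearMap.smulRight_apply, h4, map_smul]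
    rfl
  rw [_root_.sum_apply, Finset.sum_congr rfl fun i _ => hleib i,
    Finset.sum_add_distrib, ← map_sum]
  congr 2
  exact b.sum_repr _

/-- The Leibniz rule in a local frame, with the derivative of the coefficients split off. -/
theorem CovariantDerivative.frameSection_apply' {q x : M} (hx : x ∈ (chartAt E q).source)
    {g : M → E} (hg : MDifferentiableAt 𝓘(ℝ, E) 𝓘(ℝ, E) g x) (u : TangentSpace 𝓘(ℝ, E) x) :
    cov (frameSection q g) x u = cov (frameSection q fun _ => g x) x u
      + (tangentTriv E q).symmL ℝ x (mfderiv 𝓘(ℝ, E) 𝓘(ℝ, E) g x u) := by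
  rw [cov.frameSection_apply hx hg, cov.frameSection_apply hx mdifferentiableAt_const, mfderiv_const]
  congr 1
  change _ = _ + (tangentTriv E q).symmL ℝ x 0
  rw [map_zero, add_zero]

/-- The covariant derivative along a curve, computed in the frame of a fixed chart. -/
theorem covDerivAlong_eq_in_frame {q : M} {γ : ℝ → M}
    {V : ∀ t, TangentSpace 𝓘(ℝ, E) (γ t)} {t₀ : ℝ}
    (hγ : MDifferentiableAt 𝓘(ℝ, ℝ) 𝓘(ℝ, E) γ t₀) (ht : γ t₀ ∈ (chartAt E q).source)
    (hV : DifferentiableAt ℝ (fun t => (tangentTriv E q ⟨γ t, V t⟩).2) t₀) :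
    covDerivAlong cov γ V t₀ =
      (tangentTriv E q).symmL ℝ (γ t₀) (deriv (fun t => (tangentTriv E q ⟨γ t, V t⟩).2) t₀) +
      cov (frameSection q fun _ => (tangentTriv E q ⟨γ t₀, V t₀⟩).2) (γ t₀) (velocity E γ t₀) := by
  set x := γ t₀ with hx
  set e := tangentTriv E q
  set e' := tangentTriv E x
  have hxe : x ∈ e.baseSet := ht
  have hxe' : x ∈ e'.baseSet := mem_chart_source E x
  have hb : (e.baseSet ∩ e'.baseSet) ∈ 𝓝 x :=
    (e.open_baseSet.inter e'.open_baseSet).mem_nhds ⟨hxe, hxe'⟩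
  -- The transition from the frame at `q` to the frame at `x`. Its derivative along the velocity
  -- appears on both sides: from differentiating the components of `V` in the frame at `x`, and from
  -- the Leibniz rule for the `q`-constant field written in that frame.
  set A : M → E →L[ℝ] E := fun y => e.coordChangeL ℝ e' y
  set a : ℝ → E := fun t => (e ⟨γ t, V t⟩).2
  have hA : MDifferentiableAt 𝓘(ℝ, E) 𝓘(ℝ, E →L[ℝ] E) A x :=
    (contMDiffAt_coordChangeL (n := 1) hxe hxe').mdifferentiableAt one_ne_zero
  have htriv : ∀ y ∈ e.baseSet ∩ e'.baseSet, ∀ v : TangentSpace 𝓘(ℝ, E) y,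
      (e' ⟨y, v⟩).2 = A y (e ⟨y, v⟩).2 := by
    intro y hy v
    have := Trivialization.coordChangeL_apply (R := ℝ) e e' hy (e ⟨y, v⟩).2
    rw [Trivialization.symm_apply_apply_mk e hy.1] at this
    exact this.symm
  -- the derivative of the components
  set B : TangentSpace 𝓘(ℝ, E) x →L[ℝ] (E →L[ℝ] E) := mfderiv 𝓘(ℝ, E) 𝓘(ℝ, E →L[ℝ] E) A x
  have hAγ : HasDerivAt (A ∘ γ) (B (velocity E γ t₀)) t₀ := by
    have h1 : HasFDerivAt (A ∘ γ) (B.comp (mfderiv 𝓘(ℝ, ℝ) 𝓘(ℝ, E) γ t₀)) t₀ :=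
      (hA.hasMFDerivAt.comp t₀ hγ.hasMFDerivAt).hasFDerivAt
    exact h1.hasDerivAt
  have hda : deriv (fun t => (e' ⟨γ t, V t⟩).2) t₀ =
      B (velocity E γ t₀) (a t₀) + A x (deriv a t₀) := by
    have h1 : (fun t => (e' ⟨γ t, V t⟩).2) =ᶠ[𝓝 t₀] fun t => (A ∘ γ) t (a t) := by
      filter_upwards [hγ.continuousAt.preimage_mem_nhds hb] with t ht using htriv _ ht _
    rw [h1.deriv_eq]
    exact (hAγ.clm_apply hV.hasDerivAt).deriv
  -- change of frame
  have hgd : MDifferentiableAt 𝓘(ℝ, E) 𝓘(ℝ, E) (fun y => A y (a t₀)) x :=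
    hA.clm_apply mdifferentiableAt_const
  have hdg : mfderiv 𝓘(ℝ, E) 𝓘(ℝ, E) (fun y => A y (a t₀)) x (velocity E γ t₀) =
      B (velocity E γ t₀) (a t₀) := by
    let ev : (E →L[ℝ] E) →L[ℝ] E := ContinuousLinearMap.apply ℝ E (a t₀)
    have h1 := mfderiv_comp x (ev.mdifferentiableAt (x := A x)) hA
    have h2 : mfderiv 𝓘(ℝ, E →L[ℝ] E) 𝓘(ℝ, E) ev (A x) = ev := ev.mfderiv_eq
    rw [h2] at h1
    exact congrArg (fun L => L (velocity E γ t₀)) h1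
  have hframe : cov (frameSection q fun _ => a t₀) x = cov (frameSection x fun y => A y (a t₀)) x := by
    refine cov.isCovariantDerivativeOnUniv.congr_of_eventuallyEq
      (mdifferentiableAt_frameSection ht mdifferentiableAt_const)
      (mdifferentiableAt_frameSection hxe' hgd) univ_mem ?_
    filter_upwards [hb] with y hy
    simp only [frameSection]
    rw [Trivialization.symmL_apply _ hy.1, Trivialization.symmL_apply _ hy.2,
      show A y (a t₀) = _ from Trivialization.coordChangeL_apply e e' hy _,
      Trivialization.symm_apply_apply_mk e' hy.2]
  have hext : cov (FiberBundle.extend E (V t₀)) x = cov (frameSection x fun _ => A x (a t₀)) x := by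
    refine cov.isCovariantDerivativeOnUniv.congr_of_eventuallyEq
      (FiberBundle.mdifferentiableAt_extend 𝓘(ℝ, E) E (V t₀))
      (mdifferentiableAt_frameSection hxe' mdifferentiableAt_const) univ_mem ?_
    filter_upwards [e'.open_baseSet.mem_nhds hxe'] with y hy
    simp only [frameSection]
    rw [Trivialization.symmL_apply _ hy, ← htriv x ⟨hxe, hxe'⟩]
    rfl
  have hsymm : e.symmL ℝ x (deriv a t₀) = e'.symmL ℝ x (A x (deriv a t₀)) := by
    rw [Trivialization.symmL_apply _ hxe, Trivialization.symmL_apply _ hxe',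
      show A x (deriv a t₀) = _ from Trivialization.coordChangeL_apply e e' ⟨hxe, hxe'⟩ _,
      Trivialization.symm_apply_apply_mk e' hxe']
  have h0 : covDerivAlong cov γ V t₀ = e'.symmL ℝ x (deriv (fun t => (e' ⟨γ t, V t⟩).2) t₀) +
      cov (FiberBundle.extend E (V t₀)) x (velocity E γ t₀) := by
    rw [Trivialization.symmL_apply _ hxe']
    rfl
  rw [h0, hda, hext, hframe, cov.frameSection_apply' hxe' hgd, hdg, hsymm, map_add]
  abel

end LocalFrame

/-! ### The geodesic equation in a chart -/

/-- Solutions of a smooth autonomous ODE are smooth. -/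
theorem contDiffOn_of_hasDerivAt_comp {F : Type*} [NormedAddCommGroup F] [NormedSpace ℝ F]
    {f : F → F} {Ω : Set F} (hf : ContDiffOn ℝ ∞ f Ω) {Z : ℝ → F} {J : Set ℝ} (hJ : IsOpen J)
    (hZΩ : MapsTo Z J Ω) (hZ : ∀ t ∈ J, HasDerivAt Z (f (Z t)) t) : ContDiffOn ℝ ∞ Z J := by
  rw [contDiffOn_infty]
  intro n
  induction n with
  | zero => exact contDiffOn_zero.2 fun t ht => (hZ t ht).continuousAt.continuousWithinAt
  | succ n ih =>
    push_cast
    rw [contDiffOn_succ_iff_deriv_of_isOpen hJ]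
    refine ⟨fun t ht => (hZ t ht).differentiableAt.differentiableWithinAt, by simp, ?_⟩
    exact ((contDiffOn_infty.1 hf n).comp ih hZΩ).congr fun t ht => (hZ t ht).deriv

section ChartEquation

open Bundle

variable {E : Type*} [NormedAddCommGroup E] [NormedSpace ℝ E]
    {M : Type*} [TopologicalSpace M] [ChartedSpace E M] [IsManifold 𝓘(ℝ, E) ∞ M]

theorem contMDiffOn_frameSection_const (q : M) (a : E) :
    ContMDiffOn 𝓘(ℝ, E) (𝓘(ℝ, E).prod 𝓘(ℝ, E)) ∞
      (fun y => TotalSpace.mk' E y (frameSection q (fun _ => a) y)) (chartAt E q).source := by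
  intro x hx
  refine ContMDiffAt.contMDiffWithinAt ?_
  refine ((tangentTriv E q).contMDiffAt_section_iff hx).2 ?_
  refine (contMDiffAt_const (c := a)).congr_of_eventuallyEq ?_
  filter_upwards [(chartAt E q).open_source.mem_nhds hx] with y hy
  exact tangentTriv_frameSection hy _

variable [FiniteDimensional ℝ E]
    (cov : CovariantDerivative 𝓘(ℝ, E) E (TangentSpace 𝓘(ℝ, E) : M → Type _))

/-- The quadratic term of the geodesic equation in the chart at `q`. -/
noncomputable def geodesicForce (q x : M) (w : E) : E :=
  (tangentTriv E q ⟨x, cov (frameSection q fun _ => w) x (frameSection q (fun _ => w) x)⟩).2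

/-- The Christoffel symbols in the chart at `q`. -/
noncomputable def christoffelSymbol (q : M) (i j : Fin (Module.finrank ℝ E)) (x : M) : E :=
  (tangentTriv E q ⟨x, cov (frameSection q fun _ => Module.finBasis ℝ E i) x
    (frameSection q (fun _ => Module.finBasis ℝ E j) x)⟩).2

/-- Separates the quadratic dependence on `w` from the dependence on `x`, so that smoothness of the
geodesic field reduces to that of the Christoffel symbols. -/
theorem geodesicForce_eq_sum {q x : M} (hx : x ∈ (chartAt E q).source) (w : E) :
    geodesicForce cov q x w = ∑ i, ∑ j, (Module.finBasis ℝ E).repr w i •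
      (Module.finBasis ℝ E).repr w j • christoffelSymbol cov q i j x := by
  have hx' : x ∈ (tangentTriv E q).baseSet := hx
  set b := Module.finBasis ℝ E
  have h1 : frameSection q (fun _ => w) x = ∑ j, b.repr w j • frameSection q (fun _ => b j) x := by
    simp only [frameSection, ← map_smul, ← map_sum]
    rw [b.sum_repr]
  rw [geodesicForce, cov.frameSection_apply hx mdifferentiableAt_const, mfderiv_const]
  change (tangentTriv E q ⟨x, _ + (tangentTriv E q).symmL ℝ x 0⟩).2 = _
  rw [map_zero, add_zero, ← Trivialization.continuousLinearMapAt_apply_of_mem ℝ _ hx', map_sum]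
  refine Finset.sum_congr rfl fun i _ => ?_
  rw [map_smul, h1, map_sum, map_sum, Finset.smul_sum]
  refine Finset.sum_congr rfl fun j _ => ?_
  rw [map_smul, map_smul, Trivialization.continuousLinearMapAt_apply_of_mem ℝ _ hx']
  rfl

variable [T2Space M] [CovariantDerivative.ContMDiffCovariantDerivative cov ∞]

/-- The frame fields are smooth only over the chart domain, while smoothness of `cov` is applied to
global sections. A bump function extends the frame field, and locality of `cov` removes it again
near the point. -/
theorem contMDiffOn_christoffelSymbol (q : M) (i j : Fin (Module.finrank ℝ E)) :
    ContMDiffOn 𝓘(ℝ, E) 𝓘(ℝ, E) ∞ (christoffelSymbol cov q i j) (chartAt E q).source := by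
  intro x hx
  refine ContMDiffAt.contMDiffWithinAt ?_
  set a := Module.finBasis ℝ E i
  have hs : (chartAt E q).source ∈ 𝓝 x := (chartAt E q).open_source.mem_nhds hx
  obtain ⟨χ, -, hχ⟩ := (SmoothBumpFunction.nhds_basis_tsupport (I := 𝓘(ℝ, E)) x).mem_iff.1 hs
  have hσ := χ.contMDiff.contMDiffOn.smul_section_of_tsupport (chartAt E q).open_source hχ
    (contMDiffOn_frameSection_const q a)
  have hcov := ((CovariantDerivative.ContMDiffCovariantDerivative.contMDiff
    (cov := cov) (k := ∞)).contMDiff hσ.contMDiffOn).contMDiffAt (x := x) univ_mem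
  have h2 := hcov.clm_bundle_apply
    ((contMDiffOn_frameSection_const q (Module.finBasis ℝ E j)).contMDiffAt hs)
  have h3 := ((tangentTriv E q).contMDiffAt_section_iff hx).1 h2
  refine h3.congr_of_eventuallyEq ?_
  filter_upwards [χ.eventuallyEq_one.eventuallyEq_nhds, hs] with y hy hyq
  have : cov (frameSection q fun _ => a) y = cov (⇑χ • frameSection q fun _ => a) y := by
    refine cov.isCovariantDerivativeOnUniv.congr_of_eventuallyEq
      (mdifferentiableAt_frameSection hyq mdifferentiableAt_const)
      ((hσ y).mdifferentiableAt (by simp)) univ_mem ?_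
    filter_upwards [hy] with z hz
    rw [Pi.smul_apply', hz, Pi.one_apply, one_smul]
  rw [christoffelSymbol, this]

/-- The vector field of the geodesic equation, in the chart at `q`. -/
noncomputable def geodesicField (q : M) (z : E × E) : E × E :=
  (z.2, -geodesicForce cov q ((chartAt E q).symm z.1) z.2)

theorem contDiffOn_geodesicField (q : M) :
    ContDiffOn ℝ ∞ (geodesicField cov q) ((chartAt E q).target ×ˢ univ) := by
  refine contDiffOn_snd.prodMk (ContDiffOn.neg ?_)
  have hc : ∀ i j, ContDiffOn ℝ ∞
      (fun z : E × E => christoffelSymbol cov q i j ((chartAt E q).symm z.1))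
      ((chartAt E q).target ×ˢ univ) := by
    intro i j
    have h1 : ContDiffOn ℝ ∞ (christoffelSymbol cov q i j ∘ (chartAt E q).symm)
        (chartAt E q).target :=
      ((contMDiffOn_christoffelSymbol cov q i j).comp (contMDiffOn_chart_symm (I := 𝓘(ℝ, E)))
        (chartAt E q).mapsTo_symm).contDiffOn
    exact h1.comp contDiffOn_fst fun z hz => hz.1
  have hr : ∀ i, ContDiff ℝ ∞ fun z : E × E => (Module.finBasis ℝ E).repr z.2 i := fun i =>
    ((Module.finBasis ℝ E).coord i).toContinuousLinearMap.contDiff.comp contDiff_snd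
  refine ContDiffOn.congr (f := fun z : E × E => ∑ i, ∑ j, (Module.finBasis ℝ E).repr z.2 i •
      (Module.finBasis ℝ E).repr z.2 j • christoffelSymbol cov q i j ((chartAt E q).symm z.1))
    ?_ fun z hz => geodesicForce_eq_sum cov ((chartAt E q).map_target hz.1) z.2
  exact ContDiffOn.sum fun i _ => ContDiffOn.sum fun j _ =>
    (hr i).contDiffOn.smul ((hr j).contDiffOn.smul (hc i j))

end ChartEquation

section ChartEquation

open Bundle

variable {E : Type*} [NormedAddCommGroup E] [NormedSpace ℝ E] [FiniteDimensional ℝ E]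
    {M : Type*} [TopologicalSpace M] [ChartedSpace E M] [IsManifold 𝓘(ℝ, E) ∞ M]
    (cov : CovariantDerivative 𝓘(ℝ, E) E (TangentSpace 𝓘(ℝ, E) : M → Type _))

/-- The geodesic equation in the chart at `q`. -/
theorem covDerivAlong_velocity_eq_zero_iff {q : M} {γ : ℝ → M} {t : ℝ}
    (hγ : ContMDiffAt 𝓘(ℝ, ℝ) 𝓘(ℝ, E) ∞ γ t) (ht : γ t ∈ (chartAt E q).source) :
    covDerivAlong cov γ (velocity E γ) t = 0 ↔
      deriv (deriv (chartAt E q ∘ γ)) t =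
        -geodesicForce cov q (γ t) (deriv (chartAt E q ∘ γ) t) := by
  have hx' : γ t ∈ (tangentTriv E q).baseSet := ht
  have hs : (chartAt E q).source ∈ 𝓝 (γ t) := (chartAt E q).open_source.mem_nhds ht
  have hy : ContDiffAt ℝ ∞ (chartAt E q ∘ γ) t :=
    (((contMDiffOn_chart (I := 𝓘(ℝ, E)) (n := ∞)).contMDiffAt hs).comp t hγ).contDiffAt
  have hvel : (fun s => (tangentTriv E q ⟨γ s, velocity E γ s⟩).2) =ᶠ[𝓝 t]
      deriv (chartAt E q ∘ γ) := by
    have h1 : ∀ᶠ s in 𝓝 t, ContMDiffAt 𝓘(ℝ, ℝ) 𝓘(ℝ, E) 1 γ s :=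
      (contMDiffAt_iff_contMDiffAt_nhds (by simp)).1 (hγ.of_le (mod_cast le_top))
    filter_upwards [h1, hγ.continuousAt.preimage_mem_nhds hs] with s hs1 hs2
    exact tangentTriv_velocity (hs1.mdifferentiableAt one_ne_zero) hs2
  have hdd : DifferentiableAt ℝ (deriv (chartAt E q ∘ γ)) t :=
    (hy.derivWithin (m := ∞) le_rfl).differentiableAt (by simp)
  have hd : DifferentiableAt ℝ (fun s => (tangentTriv E q ⟨γ s, velocity E γ s⟩).2) t :=
    hdd.congr_of_eventuallyEq hvel
  have hvelt : velocity E γ t = frameSection q (fun _ => deriv (chartAt E q ∘ γ) t) (γ t) := by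
    rw [frameSection, ← hvel.eq_of_nhds, Trivialization.symmL_apply _ hx',
      Trivialization.symm_apply_apply_mk _ hx']
  rw [covDerivAlong_eq_in_frame cov (hγ.mdifferentiableAt (by simp)) ht hd, hvel.deriv_eq,
    hvel.eq_of_nhds, ← add_eq_zero_iff_eq_neg]
  set L := Trivialization.continuousLinearEquivAt ℝ (tangentTriv E q) (γ t) hx'
  rw [← L.map_eq_zero_iff, map_add]
  have h1 : L ((tangentTriv E q).symmL ℝ (γ t) (deriv (deriv (chartAt E q ∘ γ)) t)) =
      deriv (deriv (chartAt E q ∘ γ)) t :=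
    tangentTriv_frameSection ht fun _ => deriv (deriv (chartAt E q ∘ γ)) t
  rw [h1, hvelt]
  rfl

variable {cov}

/-- A geodesic solves the ODE of the geodesic field of a chart. -/
theorem IsGeodesicOn.hasDerivAt_chart {γ : ℝ → M} {J : Set ℝ} (h : IsGeodesicOn cov γ J)
    (hJ : IsOpen J) {q : M} {t : ℝ} (ht : t ∈ J) (htq : γ t ∈ (chartAt E q).source) :
    HasDerivAt (fun s => (chartAt E q (γ s), deriv (chartAt E q ∘ γ) s))
      (geodesicField cov q (chartAt E q (γ t), deriv (chartAt E q ∘ γ) t)) t := by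
  have hγ := h.1.contMDiffAt (hJ.mem_nhds ht)
  have hs : (chartAt E q).source ∈ 𝓝 (γ t) := (chartAt E q).open_source.mem_nhds htq
  have hy : ContDiffAt ℝ ∞ (chartAt E q ∘ γ) t :=
    (((contMDiffOn_chart (I := 𝓘(ℝ, E)) (n := ∞)).contMDiffAt hs).comp t hγ).contDiffAt
  have hdd : DifferentiableAt ℝ (deriv (chartAt E q ∘ γ)) t :=
    (hy.derivWithin (m := ∞) le_rfl).differentiableAt (by simp)
  have h1 := (hy.differentiableAt (by simp)).hasDerivAt
  have h2 := hdd.hasDerivAt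
  rw [(covDerivAlong_velocity_eq_zero_iff cov hγ htq).1 (h.2 t ht)] at h2
  refine (h1.prodMk h2).congr_deriv ?_
  rw [geodesicField, (chartAt E q).left_inv htq]

end ChartEquation

/-! ### States of curves in the tangent bundle -/

section CurveState

open Bundle

variable {E : Type*} [NormedAddCommGroup E] [NormedSpace ℝ E]
    {M : Type*} [TopologicalSpace M] [ChartedSpace E M]

/-- Position and velocity of a curve, as a point of the tangent bundle. -/
noncomputable def curveState (E : Type*) [NormedAddCommGroup E] [NormedSpace ℝ E]
    {M : Type*} [TopologicalSpace M] [ChartedSpace E M] (γ : ℝ → M) (t : ℝ) :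
    TangentBundle 𝓘(ℝ, E) M :=
  ⟨γ t, velocity E γ t⟩

theorem Filter.EventuallyEq.curveState_eq {γ η : ℝ → M} {t : ℝ} (h : γ =ᶠ[𝓝 t] η) :
    curveState E γ t = curveState E η t := by
  simp only [curveState, velocity, TotalSpace.mk.injEq]
  refine ⟨h.eq_of_nhds, ?_⟩
  have h1 := h.mfderiv_eq (I := 𝓘(ℝ, ℝ)) (I' := 𝓘(ℝ, E))
  have h2 := h.eq_of_nhds
  -- The tangent spaces at `γ t` and `η t` both unfold to `E`, so the derivatives can be compared as
  -- maps `ℝ →L[ℝ] E`.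
  exact congr_arg_heq (fun A : ℝ →L[ℝ] E => A (1 : ℝ)) h1

variable [IsManifold 𝓘(ℝ, E) ∞ M]

/-- Coordinates on the tangent bundle given by the preferred chart at `q`. -/
noncomputable def chartState (q : M) (ξ : TangentBundle 𝓘(ℝ, E) M) : E × E :=
  (chartAt E q ξ.proj, (tangentTriv E q ξ).2)

theorem chartState_injOn (q : M) :
    InjOn (chartState q) {ξ : TangentBundle 𝓘(ℝ, E) M | ξ.proj ∈ (chartAt E q).source} := by
  intro ξ hξ η hη h
  have h1 : ξ.proj = η.proj := (chartAt E q).injOn hξ hη (congrArg Prod.fst h)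
  have h2 : (tangentTriv E q ξ).2 = (tangentTriv E q η).2 := congrArg (fun z : E × E => z.2) h
  exact (tangentTriv E q).injOn hξ hη (Prod.ext h1 h2)

theorem chartState_curveState {q : M} {γ : ℝ → M} {t : ℝ}
    (hγ : MDifferentiableAt 𝓘(ℝ, ℝ) 𝓘(ℝ, E) γ t) (ht : γ t ∈ (chartAt E q).source) :
    chartState q (curveState E γ t) = (chartAt E q (γ t), deriv (chartAt E q ∘ γ) t) :=
  Prod.ext rfl (tangentTriv_velocity hγ ht)

theorem contMDiffOn_chartState (q : M) :
    ContMDiffOn 𝓘(ℝ, E).tangent 𝓘(ℝ, E × E) ∞ (chartState q)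
      {ξ : TangentBundle 𝓘(ℝ, E) M | ξ.proj ∈ (chartAt E q).source} := by
  have h1 : ContMDiffOn 𝓘(ℝ, E).tangent 𝓘(ℝ, E) ∞
      (fun ξ : TangentBundle 𝓘(ℝ, E) M => chartAt E q ξ.proj)
      {ξ | ξ.proj ∈ (chartAt E q).source} :=
    (contMDiffOn_chart (I := 𝓘(ℝ, E))).comp (contMDiff_proj _).contMDiffOn fun ξ hξ => hξ
  have h2 : ContMDiffOn 𝓘(ℝ, E).tangent 𝓘(ℝ, E) ∞
      (fun ξ : TangentBundle 𝓘(ℝ, E) M => (tangentTriv E q ξ).2)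
      {ξ | ξ.proj ∈ (chartAt E q).source} :=
    (((tangentTriv E q).contMDiffOn_iff (IB := 𝓘(ℝ, E)) (mapsTo_id _)).1 contMDiffOn_id).2
  exact h1.prodMk_space h2

theorem isOpen_proj_preimage_chart_source (q : M) :
    IsOpen {ξ : TangentBundle 𝓘(ℝ, E) M | ξ.proj ∈ (chartAt E q).source} :=
  (chartAt E q).open_source.preimage (FiberBundle.continuous_proj E _)

/-- A map to the tangent bundle is smooth if it is so in coordinates. -/
theorem ContMDiffOn.of_chartState {E' : Type*} [NormedAddCommGroup E'] [NormedSpace ℝ E']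
    {H' : Type*} [TopologicalSpace H'] {I' : ModelWithCorners ℝ E' H'} {N : Type*}
    [TopologicalSpace N] [ChartedSpace H' N] {f : N → TangentBundle 𝓘(ℝ, E) M} {s : Set N} {q : M}
    (hf : ∀ x ∈ s, (f x).proj ∈ (chartAt E q).source)
    (h : ContMDiffOn I' 𝓘(ℝ, E × E) ∞ (fun x => chartState q (f x)) s) :
    ContMDiffOn I' 𝓘(ℝ, E).tangent ∞ f s := by
  have h1 : ContMDiffOn I' 𝓘(ℝ, E) ∞ (fun x => (chartState q (f x)).1) s :=
    contDiff_fst.contMDiff.comp_contMDiffOn h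
  have h2 : ContMDiffOn I' 𝓘(ℝ, E) ∞ (fun x => (chartState q (f x)).2) s :=
    contDiff_snd.contMDiff.comp_contMDiffOn h
  refine ((tangentTriv E q).contMDiffOn_iff fun x hx => hf x hx).2 ⟨?_, h2⟩
  refine ((contMDiffOn_chart_symm (I := 𝓘(ℝ, E))).comp h1
    fun x hx => (chartAt E q).map_source (hf x hx)).congr fun x hx => ?_
  exact ((chartAt E q).left_inv (hf x hx)).symm

theorem ContMDiffOn.continuousAt_curveState {γ : ℝ → M} {J : Set ℝ}
    (hγ : ContMDiffOn 𝓘(ℝ, ℝ) 𝓘(ℝ, E) ∞ γ J) (hJ : IsOpen J) {t : ℝ} (ht : t ∈ J) :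
    ContinuousAt (curveState E γ) t := by
  set q := γ t
  have hs : (chartAt E q).source ∈ 𝓝 (γ t) := (chartAt E q).open_source.mem_nhds (mem_chart_source E q)
  have hγt := hγ.contMDiffAt (hJ.mem_nhds ht)
  set J' := J ∩ γ ⁻¹' (chartAt E q).source
  have hJ' : IsOpen J' := hγ.continuousOn.isOpen_inter_preimage hJ (chartAt E q).open_source
  have hy : ContDiffOn ℝ ∞ (chartAt E q ∘ γ) J' :=
    ((contMDiffOn_chart (I := 𝓘(ℝ, E)) (n := ∞)).comp (hγ.mono inter_subset_left)
      fun s hs => hs.2).contDiffOn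
  have h2 : ContDiffOn ℝ ∞ (deriv (chartAt E q ∘ γ)) J' := hy.deriv_of_isOpen hJ' le_rfl
  have h3 : ContMDiffOn 𝓘(ℝ, ℝ) 𝓘(ℝ, E).tangent ∞ (curveState E γ) J' := by
    refine ContMDiffOn.of_chartState (fun s hs => hs.2) ((hy.prodMk h2).contMDiffOn.congr ?_)
    intro s hs
    exact chartState_curveState ((hγ.contMDiffAt (hJ.mem_nhds hs.1)).mdifferentiableAt (by simp))
      hs.2
  exact h3.continuousOn.continuousAt (hJ'.mem_nhds ⟨ht, mem_chart_source E q⟩)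

end CurveState

/-! ### Existence and uniqueness of geodesics -/

section Geodesic

open Bundle

variable {E : Type*} [NormedAddCommGroup E] [NormedSpace ℝ E] [FiniteDimensional ℝ E]
    {M : Type*} [TopologicalSpace M] [ChartedSpace E M] [IsManifold 𝓘(ℝ, E) ∞ M]
    {cov : CovariantDerivative 𝓘(ℝ, E) E (TangentSpace 𝓘(ℝ, E) : M → Type _)}

/-- A solution of the ODE of the geodesic field of a chart is a geodesic. -/
theorem isGeodesicOn_of_hasDerivAt [T2Space M]
    [CovariantDerivative.ContMDiffCovariantDerivative cov ∞] {q : M} {Z : ℝ → E × E} {J : Set ℝ}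
    (hJ : IsOpen J) (hZ : ∀ t ∈ J, Z t ∈ (chartAt E q).target ×ˢ (univ : Set E))
    (hZ' : ∀ t ∈ J, HasDerivAt Z (geodesicField cov q (Z t)) t) :
    IsGeodesicOn cov (fun t => (chartAt E q).symm (Z t).1) J ∧
      ∀ t ∈ J, chartState q (curveState E (fun t => (chartAt E q).symm (Z t).1) t) = Z t := by
  set γ : ℝ → M := fun t => (chartAt E q).symm (Z t).1
  have hZs : ContDiffOn ℝ ∞ Z J :=
    contDiffOn_of_hasDerivAt_comp (contDiffOn_geodesicField cov q) hJ hZ hZ'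
  have hγ : ContMDiffOn 𝓘(ℝ, ℝ) 𝓘(ℝ, E) ∞ γ J :=
    (contMDiffOn_chart_symm (I := 𝓘(ℝ, E))).comp
      (contDiff_fst.comp_contDiffOn hZs).contMDiffOn fun t ht => (hZ t ht).1
  have hsrc : ∀ t ∈ J, γ t ∈ (chartAt E q).source := fun t ht =>
    (chartAt E q).map_target (hZ t ht).1
  have hy : EqOn (chartAt E q ∘ γ) (fun t => (Z t).1) J := fun t ht =>
    (chartAt E q).right_inv (hZ t ht).1
  have hdy : EqOn (deriv (chartAt E q ∘ γ)) (fun t => (Z t).2) J := fun t ht => by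
    rw [(hy.eventuallyEq_of_mem (hJ.mem_nhds ht)).deriv_eq]
    exact (hasFDerivAt_fst.comp_hasDerivAt t (hZ' t ht)).deriv
  refine ⟨⟨hγ, fun t ht => ?_⟩, fun t ht => ?_⟩
  · rw [covDerivAlong_velocity_eq_zero_iff cov (hγ.contMDiffAt (hJ.mem_nhds ht)) (hsrc t ht),
      (hdy.eventuallyEq_of_mem (hJ.mem_nhds ht)).deriv_eq, hdy ht]
    exact (hasFDerivAt_snd.comp_hasDerivAt t (hZ' t ht)).deriv
  · rw [chartState_curveState ((hγ.contMDiffAt (hJ.mem_nhds ht)).mdifferentiableAt (by simp))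
      (hsrc t ht), hdy ht]
    exact Prod.ext (hy ht) rfl

/-- Geodesics with the same state agree nearby. -/
theorem IsGeodesicOn.eventuallyEq [T2Space M]
    [CovariantDerivative.ContMDiffCovariantDerivative cov ∞] {γ η : ℝ → M} {J : Set ℝ}
    (hγ : IsGeodesicOn cov γ J) (hη : IsGeodesicOn cov η J) (hJ : IsOpen J) {t : ℝ} (ht : t ∈ J)
    (h : curveState E γ t = curveState E η t) : γ =ᶠ[𝓝 t] η := by
  set q := γ t
  have hq : γ t = η t := congrArg TotalSpace.proj h
  have hsγ : (chartAt E q).source ∈ 𝓝 (γ t) :=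
    (chartAt E q).open_source.mem_nhds (mem_chart_source E q)
  have hsη : (chartAt E q).source ∈ 𝓝 (η t) := hq ▸ hsγ
  have hdiff : ∀ {γ : ℝ → M}, IsGeodesicOn cov γ J → ∀ s ∈ J,
      MDifferentiableAt 𝓘(ℝ, ℝ) 𝓘(ℝ, E) γ s := fun hγ s hs =>
    (hγ.1.contMDiffAt (hJ.mem_nhds hs)).mdifferentiableAt (by simp)
  set z : (ℝ → M) → ℝ → E × E := fun γ s => (chartAt E q (γ s), deriv (chartAt E q ∘ γ) s)
  have hz0 : z γ t = z η t := by
    have h1 := congrArg (chartState q) h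
    rwa [chartState_curveState (hdiff hγ t ht) (mem_of_mem_nhds hsγ),
      chartState_curveState (hdiff hη t ht) (mem_of_mem_nhds hsη)] at h1
  have hΩ : (chartAt E q).target ×ˢ (univ : Set E) ∈ 𝓝 (z γ t) :=
    ((chartAt E q).open_target.prod isOpen_univ).mem_nhds ⟨mem_chart_target E q, mem_univ _⟩
  obtain ⟨K, s, hs, hK⟩ := (((contDiffOn_geodesicField cov q).contDiffAt hΩ).of_le
    (m := 1) (mod_cast le_top)).exists_lipschitzOnWith
  have hev : ∀ {γ : ℝ → M}, IsGeodesicOn cov γ J → (chartAt E q).source ∈ 𝓝 (γ t) →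
      s ∈ 𝓝 (z γ t) →
      ∀ᶠ r in 𝓝 t, HasDerivAt (z γ) (geodesicField cov q (z γ r)) r ∧ z γ r ∈ s := by
    intro γ hγ h1 h2
    have hcont := (hdiff hγ t ht).continuousAt
    have hzc := (hγ.hasDerivAt_chart hJ ht (mem_of_mem_nhds h1)).continuousAt
    filter_upwards [hJ.mem_nhds ht, hcont.preimage_mem_nhds h1, hzc.preimage_mem_nhds h2]
      with r hr1 hr2 hr3 using ⟨hγ.hasDerivAt_chart hJ hr1 hr2, hr3⟩
  have key : z γ =ᶠ[𝓝 t] z η := ODE_solution_unique_of_eventually (v := fun _ => geodesicField cov q)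
    (s := fun _ => s) (Eventually.of_forall fun _ => hK) (hev hγ hsγ hs) (hev hη hsη (hz0 ▸ hs)) hz0
  filter_upwards [key, (hdiff hγ t ht).continuousAt.preimage_mem_nhds hsγ,
    (hdiff hη t ht).continuousAt.preimage_mem_nhds hsη] with r h1 h2 h3
  exact (chartAt E q).injOn h2 h3 (congrArg Prod.fst h1)

/-- Geodesics on an interval which have the same state at one time agree. -/
theorem IsGeodesicOn.curveState_eq [T2Space M]
    [CovariantDerivative.ContMDiffCovariantDerivative cov ∞] {γ η : ℝ → M} {J : Set ℝ}
    (hγ : IsGeodesicOn cov γ J) (hη : IsGeodesicOn cov η J) (hJ : IsOpen J) (hJ' : J.OrdConnected)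
    {t₀ : ℝ} (ht₀ : t₀ ∈ J) (h : curveState E γ t₀ = curveState E η t₀) {t : ℝ} (ht : t ∈ J) :
    curveState E γ t = curveState E η t := by
  -- Connectedness of `J`: equality of states spreads to nearby times by local uniqueness, and
  -- inequality persists at nearby times by continuity.
  refine hJ'.isPreconnected.induction₂' (fun s t => curveState E γ s = curveState E η s →
    curveState E γ t = curveState E η t) (fun s hs => ?_) (fun _ _ _ _ _ _ h1 h2 h3 => h2 (h1 h3))
    ht₀ ht h
  by_cases hst : curveState E γ s = curveState E η s
  · have h1 := (hγ.eventuallyEq hη hJ hs hst).eventuallyEq_nhds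
    filter_upwards [mem_nhdsWithin_of_mem_nhds h1] with r hr
    exact ⟨fun _ => hr.curveState_eq, fun _ => hst⟩
  · have hne : ∀ᶠ r in 𝓝 s, curveState E γ r ≠ curveState E η r := by
      -- Points over the same base point are separated in chart coordinates, the others by the
      -- Hausdorff property of `M`.
      by_cases hq : γ s = η s
      · set q := γ s
        have hcγ := hγ.1.continuousAt_curveState hJ hs
        have hcη := hη.1.continuousAt_curveState hJ hs
        have hS := isOpen_proj_preimage_chart_source (E := E) q
        have hsγ : curveState E γ s ∈
            {ξ : TangentBundle 𝓘(ℝ, E) M | ξ.proj ∈ (chartAt E q).source} := mem_chart_source E q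
        have hsη : curveState E η s ∈
            {ξ : TangentBundle 𝓘(ℝ, E) M | ξ.proj ∈ (chartAt E q).source} := by
          change η s ∈ (chartAt E q).source
          rw [← hq]
          exact mem_chart_source E q
        have hc := (contMDiffOn_chartState (E := E) q).continuousOn
        have h1 := (hc.continuousAt (hS.mem_nhds hsγ)).comp hcγ
        have h2 := (hc.continuousAt (hS.mem_nhds hsη)).comp hcη
        have h3 := (h1.ne_iff_eventually_ne h2).1 fun h => hst (chartState_injOn q hsγ hsη h)
        filter_upwards [h3] with r hr heq using hr (congrArg (chartState q) heq)
      · have hcγ := (hγ.1.contMDiffAt (hJ.mem_nhds hs)).continuousAt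
        have hcη := (hη.1.contMDiffAt (hJ.mem_nhds hs)).continuousAt
        filter_upwards [(hcγ.ne_iff_eventually_ne hcη).1 hq] with r hr heq
          using hr (congrArg TotalSpace.proj heq)
    filter_upwards [mem_nhdsWithin_of_mem_nhds hne] with r hr
    exact ⟨fun h => absurd h hst, fun h => absurd h hr⟩

/-- The local geodesic flow. -/
theorem exists_local_geodesic_flow [T2Space M]
    (cov : CovariantDerivative 𝓘(ℝ, E) E (TangentSpace 𝓘(ℝ, E) : M → Type _))
    [CovariantDerivative.ContMDiffCovariantDerivative cov ∞] (ξ₀ : TangentBundle 𝓘(ℝ, E) M) :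
    ∃ ε > 0, ∃ (W : Set (TangentBundle 𝓘(ℝ, E) M)) (G : TangentBundle 𝓘(ℝ, E) M → ℝ → M),
      IsOpen W ∧ ξ₀ ∈ W ∧
      (∀ ξ ∈ W, IsGeodesicOn cov (G ξ) (Ioo (-ε) ε) ∧ curveState E (G ξ) 0 = ξ) ∧
      ∀ t ∈ Ioo (-ε) ε, ContMDiffOn 𝓘(ℝ, E).tangent 𝓘(ℝ, E).tangent ∞
        (fun ξ => curveState E (G ξ) t) W := by
  set q := ξ₀.proj
  have hz₀ : chartState q ξ₀ ∈ (chartAt E q).target ×ˢ (univ : Set E) :=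
    ⟨mem_chart_target E q, mem_univ _⟩
  obtain ⟨ε, hε, W, Z, hW, h0W, hZ, hZs⟩ := exists_smooth_flow
    ((chartAt E q).open_target.prod isOpen_univ) (contDiffOn_geodesicField cov q) hz₀
  set S := {ξ : TangentBundle 𝓘(ℝ, E) M | ξ.proj ∈ (chartAt E q).source}
  have hgeo : ∀ z ∈ W, _ := fun z hz => isGeodesicOn_of_hasDerivAt (cov := cov) (q := q)
    (isOpen_Ioo (a := -ε) (b := ε)) (fun t ht => ((hZ z hz).2 t ht).1)
    (fun t ht => ((hZ z hz).2 t ht).2)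
  have hsrc : ∀ z ∈ W, ∀ t ∈ Ioo (-ε) ε, (chartAt E q).symm (Z z t).1 ∈ (chartAt E q).source :=
    fun z hz t ht => (chartAt E q).map_target ((hZ z hz).2 t ht).1.1
  refine ⟨ε, hε, S ∩ chartState q ⁻¹' W, fun ξ t => (chartAt E q).symm (Z (chartState q ξ) t).1,
    (contMDiffOn_chartState q).continuousOn.isOpen_inter_preimage
      (isOpen_proj_preimage_chart_source q) hW, ⟨mem_chart_source E q, h0W⟩, ?_, ?_⟩
  · intro ξ hξ
    have h0 : (0 : ℝ) ∈ Ioo (-ε) ε := ⟨by linarith, hε⟩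
    refine ⟨(hgeo _ hξ.2).1, chartState_injOn q (hsrc _ hξ.2 0 h0) hξ.1 ?_⟩
    rw [(hgeo _ hξ.2).2 0 h0, (hZ _ hξ.2).1]
  · intro t ht
    refine ContMDiffOn.of_chartState (q := q) (fun ξ hξ => hsrc _ hξ.2 t ht) ?_
    refine (((hZs t).contMDiffOn).comp ((contMDiffOn_chartState q).mono inter_subset_left)
      fun ξ hξ => hξ.2).congr fun ξ hξ => ?_
    exact (hgeo _ hξ.2).2 t ht

end Geodesic

/-! ### Smoothness of the exponential map -/

section Translation

open Bundle

variable {E : Type*} [NormedAddCommGroup E] [NormedSpace ℝ E]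
    {M : Type*} [TopologicalSpace M] [ChartedSpace E M] [IsManifold 𝓘(ℝ, E) ∞ M]

theorem curveState_comp_sub {γ : ℝ → M} {a t : ℝ}
    (hγ : MDifferentiableAt 𝓘(ℝ, ℝ) 𝓘(ℝ, E) γ (t - a)) :
    curveState E (fun s => γ (s - a)) t = curveState E γ (t - a) := by
  have h1 : MDifferentiableAt 𝓘(ℝ, ℝ) 𝓘(ℝ, ℝ) (fun s : ℝ => s - a) t :=
    (differentiableAt_id.sub_const a).mdifferentiableAt
  have h2 : MDifferentiableAt 𝓘(ℝ, ℝ) 𝓘(ℝ, E) (fun s => γ (s - a)) t := hγ.comp t h1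
  have hs : γ (t - a) ∈ (chartAt E (γ (t - a))).source := mem_chart_source E _
  refine chartState_injOn (γ (t - a)) hs hs ?_
  rw [chartState_curveState hγ hs, chartState_curveState (γ := fun s => γ (s - a)) h2 hs]
  exact Prod.ext rfl (deriv_comp_sub_const (chartAt E (γ (t - a)) ∘ γ) a t)

variable [FiniteDimensional ℝ E]
    {cov : CovariantDerivative 𝓘(ℝ, E) E (TangentSpace 𝓘(ℝ, E) : M → Type _)}

/-- Being a geodesic is a local property. -/
theorem isGeodesicOn_of_eventuallyEq {γ : ℝ → M} {J : Set ℝ}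
    (h : ∀ t ∈ J, ∃ (η : ℝ → M) (J' : Set ℝ), IsOpen J' ∧ t ∈ J' ∧ IsGeodesicOn cov η J' ∧
      γ =ᶠ[𝓝 t] η) : IsGeodesicOn cov γ J := by
  have hs : ∀ t ∈ J, ContMDiffAt 𝓘(ℝ, ℝ) 𝓘(ℝ, E) ∞ γ t := fun t ht => by
    obtain ⟨η, J', hJ', htJ', hη, hγη⟩ := h t ht
    exact (hη.1.contMDiffAt (hJ'.mem_nhds htJ')).congr_of_eventuallyEq hγη
  refine ⟨fun t ht => (hs t ht).contMDiffWithinAt, fun t ht => ?_⟩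
  obtain ⟨η, J', hJ', htJ', hη, hγη⟩ := h t ht
  have hq : γ t = η t := hγη.eq_of_nhds
  have hy : chartAt E (γ t) ∘ γ =ᶠ[𝓝 t] chartAt E (γ t) ∘ η := hγη.fun_comp _
  have hηq : η t ∈ (chartAt E (γ t)).source := hq ▸ mem_chart_source E (γ t)
  rw [covDerivAlong_velocity_eq_zero_iff cov (hs t ht) (mem_chart_source E (γ t)),
    hy.deriv.deriv_eq, hy.deriv_eq, hq]
  rw [hq] at hηq
  exact (covDerivAlong_velocity_eq_zero_iff cov (hη.1.contMDiffAt (hJ'.mem_nhds htJ')) hηq).1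
    (hη.2 t htJ')

theorem IsGeodesicOn.comp_sub {γ : ℝ → M} {J : Set ℝ} (h : IsGeodesicOn cov γ J) (hJ : IsOpen J)
    (a : ℝ) : IsGeodesicOn cov (fun s => γ (s - a)) {s | s - a ∈ J} := by
  have hs : ∀ t, t - a ∈ J → ContMDiffAt 𝓘(ℝ, ℝ) 𝓘(ℝ, E) ∞ (fun s => γ (s - a)) t := fun t ht =>
    (h.1.contMDiffAt (hJ.mem_nhds ht)).comp t (contDiff_id.sub contDiff_const).contMDiff.contMDiffAt
  refine ⟨fun t ht => (hs t ht).contMDiffWithinAt, fun t ht => ?_⟩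
  rw [covDerivAlong_velocity_eq_zero_iff cov (hs t ht) (mem_chart_source E (γ (t - a)))]
  have h1 : deriv (chartAt E (γ (t - a)) ∘ fun s => γ (s - a)) =
      fun s => deriv (chartAt E (γ (t - a)) ∘ γ) (s - a) :=
    funext fun s => deriv_comp_sub_const (chartAt E (γ (t - a)) ∘ γ) a s
  rw [h1, deriv_comp_sub_const (deriv (chartAt E (γ (t - a)) ∘ γ)) a t]
  exact (covDerivAlong_velocity_eq_zero_iff cov (h.1.contMDiffAt (hJ.mem_nhds ht))
    (mem_chart_source E (γ (t - a)))).1 (h.2 _ ht)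

end Translation

/-! ### Smooth families of geodesics and the exponential map -/

section Exponential

open Bundle

variable {E : Type*} [NormedAddCommGroup E] [NormedSpace ℝ E]
    {M : Type*} [TopologicalSpace M] [ChartedSpace E M] [IsManifold 𝓘(ℝ, E) ∞ M]

/-- The inclusion of a fiber into the tangent bundle. -/
def tangentMk (p : M) (v : E) : TangentBundle 𝓘(ℝ, E) M := ⟨p, v⟩

theorem contMDiff_tangentMk (p : M) :
    ContMDiff 𝓘(ℝ, E) 𝓘(ℝ, E).tangent ∞ (tangentMk (E := E) p) := by
  rw [← contMDiffOn_univ]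
  refine ContMDiffOn.of_chartState (q := p) (fun v _ => mem_chart_source E p) ?_
  have hp : p ∈ (tangentTriv E p).baseSet := mem_chart_source E p
  let L : E →L[ℝ] E := Trivialization.continuousLinearMapAt ℝ (tangentTriv E p) p
  have h : ContDiff ℝ ∞ fun v : E => (chartAt E p p, L v) := contDiff_const.prodMk L.contDiff
  refine h.contMDiff.contMDiffOn.congr fun v _ => Prod.ext rfl ?_
  exact (Trivialization.continuousLinearMapAt_apply_of_mem ℝ (tangentTriv E p) hp v).symm

/-- A family of geodesics from `p`, parametrized by the initial velocities near `v₀` and defined on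
an interval containing `0` and `t`, whose states at time `t` depend smoothly on the parameter. -/
def HasSmoothGeodesicFamily
    (cov : CovariantDerivative 𝓘(ℝ, E) E (TangentSpace 𝓘(ℝ, E) : M → Type _))
    (p : M) (v₀ : E) (t : ℝ) : Prop :=
  ∃ (N : Set E) (J : Set ℝ) (G : E → ℝ → M), IsOpen N ∧ v₀ ∈ N ∧ IsOpen J ∧ J.OrdConnected ∧
    0 ∈ J ∧ t ∈ J ∧ (∀ v ∈ N, IsGeodesicOn cov (G v) J ∧ curveState E (G v) 0 = tangentMk p v) ∧
    ContMDiffOn 𝓘(ℝ, E) 𝓘(ℝ, E).tangent ∞ (fun v => curveState E (G v) t) N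

variable [FiniteDimensional ℝ E] [T2Space M]
    (cov : CovariantDerivative 𝓘(ℝ, E) E (TangentSpace 𝓘(ℝ, E) : M → Type _))
    [CovariantDerivative.ContMDiffCovariantDerivative cov ∞]

theorem hasSmoothGeodesicFamily_zero (p : M) (v₀ : E) : HasSmoothGeodesicFamily cov p v₀ 0 := by
  obtain ⟨ε, hε, W, G, hW, h0W, hG, hGs⟩ := exists_local_geodesic_flow cov (tangentMk p v₀)
  have hmk := contMDiff_tangentMk (E := E) p
  have h0 : (0 : ℝ) ∈ Ioo (-ε) ε := ⟨by linarith, hε⟩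
  exact ⟨tangentMk p ⁻¹' W, Ioo (-ε) ε, fun v => G (tangentMk p v), hW.preimage hmk.continuous, h0W,
    isOpen_Ioo, ordConnected_Ioo, h0, h0, fun v hv => hG _ hv,
    (hGs 0 h0).comp hmk.contMDiffOn fun v hv => hv⟩

variable {cov}

/-- The states at time `t₀` are fed into the local flow for the time `t - t₀`, so the states at `t`
depend smoothly on `v` by composition. The flow box `W` need not be centred at the state at `t₀`,
which permits steps both away from and towards its centre. -/
theorem HasSmoothGeodesicFamily.step {p : M} {v₀ : E} {t₀ t ε : ℝ}
    (h : HasSmoothGeodesicFamily cov p v₀ t₀) {γ : ℝ → M} {J₀ : Set ℝ} (hJ₀ : IsOpen J₀)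
    (hJ₀' : J₀.OrdConnected) (h0 : 0 ∈ J₀) (ht₀ : t₀ ∈ J₀) (hγ : IsGeodesicOn cov γ J₀)
    (hγ0 : curveState E γ 0 = tangentMk p v₀) {W : Set (TangentBundle 𝓘(ℝ, E) M)}
    {Φ : TangentBundle 𝓘(ℝ, E) M → ℝ → M} (hW : IsOpen W)
    (hΦ : ∀ ξ ∈ W, IsGeodesicOn cov (Φ ξ) (Ioo (-ε) ε) ∧ curveState E (Φ ξ) 0 = ξ)
    (hΦs : ∀ s ∈ Ioo (-ε) ε, ContMDiffOn 𝓘(ℝ, E).tangent 𝓘(ℝ, E).tangent ∞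
        (fun ξ => curveState E (Φ ξ) s) W)
    (hγW : curveState E γ t₀ ∈ W) (ht : t - t₀ ∈ Ioo (-ε) ε) :
    HasSmoothGeodesicFamily cov p v₀ t := by
  classical
  obtain ⟨N, J, G, hN, hvN, hJ, hJ', h0J, ht₀J, hG, hGs⟩ := h
  have hε : 0 < ε := by linarith [ht.1, ht.2]
  -- Uniqueness identifies `G v₀` with `γ` at time `t₀`; hence `v₀` survives the restriction to
  -- parameters whose state lies in `W`.
  have hGγ : curveState E (G v₀) t₀ = curveState E γ t₀ := by
    have h1 : IsGeodesicOn cov (G v₀) (J ∩ J₀) :=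
      ⟨(hG v₀ hvN).1.1.mono inter_subset_left, fun s hs => (hG v₀ hvN).1.2 s hs.1⟩
    have h2 : IsGeodesicOn cov γ (J ∩ J₀) :=
      ⟨hγ.1.mono inter_subset_right, fun s hs => hγ.2 s hs.2⟩
    exact h1.curveState_eq h2 (hJ.inter hJ₀) (hJ'.inter hJ₀') ⟨h0J, h0⟩
      ((hG v₀ hvN).2.trans hγ0.symm) ⟨ht₀J, ht₀⟩
  set N' := N ∩ (fun v => curveState E (G v) t₀) ⁻¹' W
  have hN' : IsOpen N' := hGs.continuousOn.isOpen_inter_preimage hN hW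
  set I : Set ℝ := {s | s - t₀ ∈ Ioo (-ε) ε}
  have hII : I = Ioo (t₀ - ε) (t₀ + ε) := by
    ext s
    simp only [I, mem_ofPred_eq, mem_Ioo]
    constructor <;> rintro ⟨h1, h2⟩ <;> constructor <;> linarith
  have hI : IsOpen I := hII ▸ isOpen_Ioo
  have hI' : I.OrdConnected := hII ▸ ordConnected_Ioo
  have ht₀I : t₀ ∈ I := by
    rw [hII]; constructor <;> linarith
  set η : E → ℝ → M := fun v s => Φ (curveState E (G v) t₀) (s - t₀)
  have hη : ∀ v ∈ N', IsGeodesicOn cov (η v) I := fun v hv => (hΦ _ hv.2).1.comp_sub isOpen_Ioo t₀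
  have hηs : ∀ v ∈ N', ∀ s ∈ I,
      curveState E (η v) s = curveState E (Φ (curveState E (G v) t₀)) (s - t₀) := fun v hv s hs =>
    curveState_comp_sub (((hΦ _ hv.2).1.1.contMDiffAt (isOpen_Ioo.mem_nhds hs)).mdifferentiableAt
      (by simp))
  -- On `J ∩ I` the two geodesics have the same state at `t₀` and therefore agree, so preferring `G
  -- v` there is immaterial.
  set G' : E → ℝ → M := fun v s => if s ∈ J then G v s else η v s
  have hGJ : ∀ v, EqOn (G' v) (G v) J := fun v s hs => if_pos hs
  have hGI : ∀ v ∈ N', EqOn (G' v) (η v) I := by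
    intro v hv s hs
    by_cases hsJ : s ∈ J
    · rw [hGJ v hsJ]
      have h1 : IsGeodesicOn cov (G v) (J ∩ I) :=
        ⟨(hG v hv.1).1.1.mono inter_subset_left, fun s hs => (hG v hv.1).1.2 s hs.1⟩
      have h2 : IsGeodesicOn cov (η v) (J ∩ I) :=
        ⟨(hη v hv).1.mono inter_subset_right, fun s hs => (hη v hv).2 s hs.2⟩
      refine congrArg TotalSpace.proj (h1.curveState_eq h2 (hJ.inter hI) (hJ'.inter hI')
        ⟨ht₀J, ht₀I⟩ ?_ ⟨hsJ, hs⟩)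
      rw [hηs v hv t₀ ht₀I, sub_self, (hΦ _ hv.2).2]
    · exact if_neg hsJ
  have hnhdJ : ∀ v, ∀ s ∈ J, G' v =ᶠ[𝓝 s] G v := fun v s hs =>
    (hGJ v).eventuallyEq_of_mem (hJ.mem_nhds hs)
  have hnhdI : ∀ v ∈ N', ∀ s ∈ I, G' v =ᶠ[𝓝 s] η v := fun v hv s hs =>
    (hGI v hv).eventuallyEq_of_mem (hI.mem_nhds hs)
  have hJI : (J ∪ I).OrdConnected := isPreconnected_iff_ordConnected.1
    (hJ'.isPreconnected.union t₀ ht₀J ht₀I hI'.isPreconnected)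
  refine ⟨N', J ∪ I, G', hN', ⟨hvN, by rw [mem_preimage, hGγ]; exact hγW⟩, hJ.union hI, hJI,
    Or.inl h0J, Or.inr ht, fun v hv => ⟨isGeodesicOn_of_eventuallyEq ?_, ?_⟩, ?_⟩
  · rintro s (hs | hs)
    · exact ⟨G v, J, hJ, hs, (hG v hv.1).1, hnhdJ v s hs⟩
    · exact ⟨η v, I, hI, hs, hη v hv, hnhdI v hv s hs⟩
  · rw [(hnhdJ v 0 h0J).curveState_eq, (hG v hv.1).2]
  · refine ((hΦs _ ht).comp (hGs.mono inter_subset_left) fun v hv => hv.2).congr fun v hv => ?_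
    rw [(hnhdI v hv t ht).curveState_eq, hηs v hv t ht]
    rfl

/-- Around a geodesic there is a smooth family of geodesics. -/
theorem IsGeodesicOn.hasSmoothGeodesicFamily {p : M} {v₀ : E} {γ : ℝ → M} {J : Set ℝ}
    (hγ : IsGeodesicOn cov γ J) (hJ : IsOpen J) (hJ' : J.OrdConnected) (h0 : 0 ∈ J)
    (hγ0 : curveState E γ 0 = tangentMk p v₀) {t : ℝ} (ht : t ∈ J) :
    HasSmoothGeodesicFamily cov p v₀ t := by
  -- One flow box around the state of `γ` at `s` connects `s` with all nearby times `r`, in both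
  -- directions.
  refine hJ'.isPreconnected.induction₂' (fun s t => HasSmoothGeodesicFamily cov p v₀ s →
    HasSmoothGeodesicFamily cov p v₀ t) (fun s hs => ?_) (fun _ _ _ _ _ _ h1 h2 h3 => h2 (h1 h3))
    h0 ht (hasSmoothGeodesicFamily_zero cov p v₀)
  obtain ⟨ε, hε, W, Φ, hW, hsW, hΦ, hΦs⟩ := exists_local_geodesic_flow cov (curveState E γ s)
  have hcont := (hγ.1.continuousAt_curveState hJ hs).preimage_mem_nhds (hW.mem_nhds hsW)
  filter_upwards [self_mem_nhdsWithin, mem_nhdsWithin_of_mem_nhds hcont,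
    mem_nhdsWithin_of_mem_nhds (Ioo_mem_nhds (sub_lt_self s hε) (lt_add_of_pos_right s hε))]
    with r hr hrW hrs
  exact ⟨fun h => h.step hJ hJ' h0 hs hγ hγ0 hW hΦ hΦs hsW
      ⟨by linarith [hrs.1], by linarith [hrs.2]⟩,
    fun h => h.step hJ hJ' h0 hr hγ hγ0 hW hΦ hΦs hrW ⟨by linarith [hrs.2], by linarith [hrs.1]⟩⟩

variable (cov)

/-- Near a point of its domain, the exponential map is defined and smooth. -/
theorem exists_nhds_contMDiffOn_expMap (p : M) {v₀ : E} (hv₀ : v₀ ∈ expDomain cov p) :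
    ∃ N : Set E, IsOpen N ∧ v₀ ∈ N ∧ N ⊆ expDomain cov p ∧
      ContMDiffOn 𝓘(ℝ, E) 𝓘(ℝ, E) ∞ (fun v : E => expMap cov p v) N := by
  obtain ⟨γ, ⟨J₀, hJ₀, hJ₀', h0, h1, hγ⟩, hγ0⟩ := hv₀
  obtain ⟨N, J, G, hN, hvN, hJ, hJ', h0J, h1J, hG, hGs⟩ :=
    hγ.hasSmoothGeodesicFamily hJ₀ hJ₀' h0 hγ0 h1
  have hdom : ∀ v ∈ N, IsGeodesicFrom cov p v (G v) := fun v hv =>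
    ⟨⟨J, hJ, hJ', h0J, h1J, (hG v hv).1⟩, (hG v hv).2⟩
  refine ⟨N, hN, hvN, fun v hv => ⟨G v, hdom v hv⟩, ?_⟩
  refine ((contMDiff_proj (TangentSpace 𝓘(ℝ, E) : M → Type _)).comp_contMDiffOn hGs).congr
    fun v hv => ?_
  have hex : ∃ η : ℝ → M, IsGeodesicFrom cov p v η := ⟨G v, hdom v hv⟩
  have hexp : expMap cov p v = hex.choose 1 := dif_pos hex
  rw [hexp]
  -- The geodesic chosen in `expMap` need not be `G v`, but by uniqueness both have the same
  -- position at time `1`.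
  obtain ⟨⟨J₁, hJ₁, hJ₁', h0J₁, h1J₁, hη⟩, hη0⟩ := hex.choose_spec
  have h1 : IsGeodesicOn cov hex.choose (J ∩ J₁) :=
    ⟨hη.1.mono inter_subset_right, fun s hs => hη.2 s hs.2⟩
  have h2 : IsGeodesicOn cov (G v) (J ∩ J₁) :=
    ⟨(hG v hv).1.1.mono inter_subset_left, fun s hs => (hG v hv).1.2 s hs.1⟩
  exact congrArg TotalSpace.proj (h1.curveState_eq h2 (hJ.inter hJ₁) (hJ'.inter hJ₁') ⟨h0J, h0J₁⟩
    (hη0.trans (hG v hv).2.symm) ⟨h1J, h1J₁⟩)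

/-- The exponential map has an open domain. -/
theorem isOpen_expDomain (p : M) : IsOpen (X := E) (expDomain cov p) := by
  refine isOpen_iff_mem_nhds.2 fun v hv => ?_
  obtain ⟨N, hN, hvN, hND, -⟩ := exists_nhds_contMDiffOn_expMap cov p hv
  exact mem_of_superset (hN.mem_nhds hvN) hND

/-- The exponential map is smooth. -/
theorem contMDiffOn_expMap (p : M) :
    ContMDiffOn 𝓘(ℝ, E) 𝓘(ℝ, E) ∞ (fun v : E => expMap cov p v) (expDomain cov p) := by
  intro v hv
  obtain ⟨N, hN, hvN, -, hs⟩ := exists_nhds_contMDiffOn_expMap cov p hv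
  exact (hs.contMDiffAt (hN.mem_nhds hvN)).contMDiffWithinAt

end Exponential

/-! ### Weak properness and continuation for the exponential map -/

theorem proposition4p3
    {E : Type*} [NormedAddCommGroup E] [NormedSpace ℝ E] [FiniteDimensional ℝ E]
    {M : Type*} [TopologicalSpace M] [ChartedSpace E M] [IsManifold 𝓘(ℝ, E) ∞ M]
    [T2Space M] [SecondCountableTopology M]
    (cov : CovariantDerivative 𝓘(ℝ, E) E (TangentSpace 𝓘(ℝ, E) : M → Type _))
    [CovariantDerivative.ContMDiffCovariantDerivative cov ∞] (p : M) :
    IsWeaklyProper (expMap cov p) (expDomain cov p) ↔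
      HasContinuationProperty (expMap cov p) (expDomain cov p) (piecewiseSmoothPaths E M) := by
  have : ProperSpace E := FiniteDimensional.proper ℝ E
  -- Being locally compact and Hausdorff, `M` is regular, which provides the closed neighborhoods of
  -- the limit point.
  have : LocallyCompactSpace M := ChartedSpace.locallyCompactSpace E M
  constructor
  · intro h
    exact IsWeaklyProper.hasContinuationProperty (E := E) h fun α hα => hα.1
  · intro h
    exact HasContinuationProperty.isWeaklyProper (E := E) (isOpen_expDomain cov p)
      (contMDiffOn_expMap cov p) h
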